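/- Let $R>1$ be an integer and let $B,L\subset\mathbb Z$ be finite sets with $0\in B$, $0\in L$ and $|B|=N$. Let $X_B=\{\sum_{k\ge1}R^{-k}b_k: b_k\in B\}$ be the attractor of the iterated function system $\tau_b(x)=R^{-1}(x+b)$, $b\in B$, and let $\mu_B$ be its invariant measure, i.e. the unique Borel probability measure on $\mathbb R$ with $\int f\,d\mu_B=\frac1N\sum_{b\in B}\int f\circ\tau_b\,d\mu_B$ for all continuous compactly supported $f$. Assume that there is no overlap, i.e. $\mu_B(\tau_b(X_B)\cap\tau_{b'}(X_B))=0$ for all $b\ne b'$ in $B$, and that $L$ is a spectrum for $\frac1RB$, i.e. $|L|=N$ and the matrix $\frac1{\sqrt N}\,[e^{2\pi i R^{-1}bl}]_{b\in B,\,l\in L}$ is unitary. Write $e_t(x)=e^{2\pi i t x}$, and let $r:X_B\to X_B$ be given by $r(x)=\tau_b^{-1}(x)=Rx-b$ for $x\in\tau_b(X_B)$ (well defined $\mu_B$-almost everywhere). For $l\in L$ let $S_lf=e_l\cdot (f\circ r)$, and for a finite word $w=l_1\cdots l_n$ with letters in $L$ (possibly empty) let $S_w=S_{l_1}\cdots S_{l_n}$.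 With $m_B(x)=\frac1N\sum_{b\in B}e^{2\pi i b x}$, call $c\in\mathbb R$ an extreme cycle point for $(B,L)$ if there are $p\ge1$, $l_0,\dots,l_{p-1}\in L$ and points $c_0=c,c_1,\dots,c_p=c$ with $c_{i+1}=\frac{c_i+l_i}{R}$ and $|m_B(c_i)|=1$ for $0\le i<p$. Then for every finite word $w$ with letters in $L$ and every extreme cycle point $c$, the function $S_we_{-c}$ is a pure exponential: it equals $e_\lambda$ in $L^2(\mu_B)$ for some $\lambda\in\mathbb R$. Moreover there is a set $\Lambda\subset\mathbb R$ such that $\{e_\lambda:\lambda\in\Lambda\}$ is an orthonormal basis of $L^2(\mu_B)$ and, as sets of vectors in $L^2(\mu_B)$, $\{e_\lambda:\lambda\in\Lambda\}=\{S_we_{-c}: w \text{ a finite word with letters in } L,\ c \text{ an extreme cycle point for } (B,L)\}$. -/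

import Mathlib

open MeasureTheory
open scoped ENNReal

namespace CuntzBasis

noncomputable section

/-- The exponential function `e_t(x) = exp(2 π i t x)` on the real line. -/
def expFun (t x : ℝ) : ℂ := Complex.exp (2 * Real.pi * Complex.I * t * x)

/-- The maps `τ_b(x) = R⁻¹ (x + b)` of the affine iterated function system. -/
def ifsMap (R b x : ℝ) : ℝ := R⁻¹ * (x + b)

/-- The point `∑_{k ≥ 1} R^{-k} b_k` with digits `b_1, b_2, …` in `B`
(the digit `b_k` is `ω (k - 1)`). -/
def ifsPoint (R : ℝ) (B : Finset ℝ) (ω : ℕ → B) : ℝ := ∑' k, R⁻¹ ^ (k + 1) * (ω k : ℝ)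

/-- The attractor `X_B = {∑_{k ≥ 1} R^{-k} b_k : b_k ∈ B}` of the system `(τ_b)_{b ∈ B}`.
By `attractor_unique` below, for `R > 1` and `B` non-empty, it is the unique non-empty
compact set `X` with `X = ⋃_{b ∈ B} τ_b(X)`. -/
def attractor (R : ℝ) (B : Finset ℝ) : Set ℝ := Set.range (ifsPoint R B)

/-- `μ` is the invariant measure of the system `(τ_b)_{b ∈ B}`: a Borel probability measure with
`∫ f dμ = (1 / N) ∑_{b ∈ B} ∫ f ∘ τ_b dμ` for all continuous compactly supported `f`.
By `existsUnique_isInvariantMeasure` below, there is exactly one such measure when `R > 1` and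
`B` is non-empty. -/
structure IsInvariantMeasure (R : ℝ) (B : Finset ℝ) (μ : Measure ℝ) : Prop where
  isProbabilityMeasure : IsProbabilityMeasure μ
  integral_eq : ∀ f : ℝ → ℝ, Continuous f → HasCompactSupport f →
    ∫ x, f x ∂μ = (B.card : ℝ)⁻¹ * ∑ b ∈ B, ∫ x, f (ifsMap R b x) ∂μ

/-- The system `(τ_b)_{b ∈ B}` has no overlap: the pieces `τ_b(X_B)` of the attractor intersect
pairwise in sets of measure zero. -/
def NoOverlap (R : ℝ) (B : Finset ℝ) (μ : Measure ℝ) : Prop :=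
  ∀ b ∈ B, ∀ b' ∈ B, b ≠ b' →
    μ (ifsMap R b '' attractor R B ∩ ifsMap R b' '' attractor R B) = 0

/-- `L` is a spectrum for the finite set `A`: `|L| = |A|` and the matrix
`(1 / √|A|) [exp(2 π i a l)]_{a ∈ A, l ∈ L}` is unitary. -/
def IsSpectrum (A L : Finset ℝ) : Prop :=
  L.card = A.card ∧
    let M : Matrix A L ℂ := Matrix.of fun a l => ((√(A.card : ℝ))⁻¹ : ℂ) * expFun a l
    M * M.conjTranspose = 1 ∧ M.conjTranspose * M = 1

open Classical in
/-- The map `r(x) = τ_b⁻¹(x) = R x - b` if `x ∈ τ_b(X_B)`. Where several `b` are possible (a null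
set if there is no overlap) one of them is chosen; off the attractor (a null set) `r(x) = x`. -/
def shiftMap (R : ℝ) (B : Finset ℝ) (x : ℝ) : ℝ :=
  if h : ∃ b ∈ B, x ∈ ifsMap R b '' attractor R B then R * x - h.choose else x

/-- The operator `S_l f = e_l · (f ∘ r)`. -/
def cuntzOp (R : ℝ) (B : Finset ℝ) (l : ℝ) (f : ℝ → ℂ) : ℝ → ℂ :=
  fun x => expFun l x * f (shiftMap R B x)

/-- `S_w = S_{l_1} S_{l_2} ⋯ S_{l_n}` for the word `w = l_1 l_2 … l_n`; the empty word gives the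
identity. -/
def cuntzWord (R : ℝ) (B : Finset ℝ) (w : List ℝ) (f : ℝ → ℂ) : ℝ → ℂ :=
  w.foldr (cuntzOp R B) f

/-- `m_B(x) = (1 / N) ∑_{b ∈ B} exp(2 π i b x)`. -/
def maskFun (B : Finset ℝ) (x : ℝ) : ℂ := (B.card : ℂ)⁻¹ * ∑ b ∈ B, expFun b x

/-- `c` is an extreme cycle point for `(B, L)`: there are `p ≥ 1`, digits `l_0, …, l_{p-1}` in `L`
and points `c_0 = c, c_1, …, c_p = c` with `c_{i+1} = (c_i + l_i) / R` and `|m_B(c_i)| = 1` for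
`0 ≤ i < p`. -/
def IsExtremeCyclePoint (R : ℝ) (B L : Finset ℝ) (c : ℝ) : Prop :=
  ∃ (p : ℕ) (l x : ℕ → ℝ), 0 < p ∧ x 0 = c ∧ x p = c ∧
    ∀ i < p, l i ∈ L ∧ x (i + 1) = (x i + l i) / R ∧ ‖maskFun B (x i)‖ = 1

/-- The set `ℰ(L)` of the classes in `L²(μ)` of the functions `S_w e_{-c}`, where `w` is a finite
word with letters in `L` and `c` is an extreme cycle point for `(B, L)`. -/
def cycleFamily (R : ℝ) (B L : Finset ℝ) (μ : Measure ℝ) : Set (Lp ℂ 2 μ) :=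
  {v | ∃ (w : List ℝ) (c : ℝ), (∀ l ∈ w, l ∈ L) ∧ IsExtremeCyclePoint R B L c ∧
    v =ᵐ[μ] cuntzWord R B w (expFun (-c))}

/-! ### Existence and uniqueness of the attractor and of the invariant measure -/

theorem ifsPoint_bound {R : ℝ} (hR : 1 < R) (B : Finset ℝ) (k : ℕ) (b : B) :
    ‖R⁻¹ ^ (k + 1) * (b : ℝ)‖ ≤ R⁻¹ ^ (k + 1) * ∑ b ∈ B, |b| := by
  have h : (0 : ℝ) ≤ R⁻¹ := by positivity
  rw [norm_mul, Real.norm_of_nonneg (by positivity), Real.norm_eq_abs]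
  gcongr
  exact Finset.single_le_sum (f := fun b : ℝ => |b|) (fun _ _ => abs_nonneg _) b.2

theorem ifsPoint_summable_bound {R : ℝ} (hR : 1 < R) (B : Finset ℝ) :
    Summable fun k : ℕ => R⁻¹ ^ (k + 1) * ∑ b ∈ B, |b| := by
  have h : Summable fun k : ℕ => R⁻¹ ^ k :=
    summable_geometric_of_lt_one (by positivity) (inv_lt_one_of_one_lt₀ hR)
  exact ((summable_nat_add_iff 1).2 h).mul_right _

theorem ifsPoint_summable {R : ℝ} (hR : 1 < R) (B : Finset ℝ) (ω : ℕ → B) :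
    Summable fun k : ℕ => R⁻¹ ^ (k + 1) * (ω k : ℝ) :=
  (ifsPoint_summable_bound hR B).of_norm_bounded fun k => ifsPoint_bound hR B k (ω k)

theorem continuous_ifsPoint {R : ℝ} (hR : 1 < R) (B : Finset ℝ) :
    Continuous (ifsPoint R B) :=
  continuous_tsum (fun k => by fun_prop) (ifsPoint_summable_bound hR B)
    fun k ω => ifsPoint_bound hR B k (ω k)

theorem ifsPoint_eq {R : ℝ} (hR : 1 < R) (B : Finset ℝ) (ω : ℕ → B) :
    ifsPoint R B ω = ifsMap R (ω 0) (ifsPoint R B fun k => ω (k + 1)) := by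
  unfold ifsPoint ifsMap
  rw [(ifsPoint_summable hR B ω).tsum_eq_zero_add, mul_add, ← tsum_mul_left]
  simp only [zero_add, pow_one]
  rw [add_comm]
  congr 2
  ext k
  ring

theorem dist_ifsMap {R : ℝ} (hR : 1 < R) (b x y : ℝ) :
    |ifsMap R b x - ifsMap R b y| = R⁻¹ * |x - y| := by
  unfold ifsMap
  rw [← mul_sub, abs_mul, abs_of_pos (by positivity : (0 : ℝ) < R⁻¹)]
  congr 2
  ring

/-- The attractor is compact, non-empty and invariant. -/
theorem attractor_spec {R : ℝ} (hR : 1 < R) {B : Finset ℝ} (hB : B.Nonempty) :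
    IsCompact (attractor R B) ∧ (attractor R B).Nonempty ∧
      attractor R B = ⋃ b ∈ B, ifsMap R b '' attractor R B := by
  have : Nonempty B := hB.to_subtype
  refine ⟨isCompact_range (continuous_ifsPoint hR B), Set.range_nonempty _, ?_⟩
  ext x
  simp only [Set.mem_iUnion, Set.mem_image, attractor, Set.mem_range, exists_prop]
  constructor
  · rintro ⟨ω, rfl⟩
    exact ⟨ω 0, (ω 0).2, _, ⟨_, rfl⟩, (ifsPoint_eq hR B ω).symm⟩
  · rintro ⟨b, hb, _, ⟨ω, rfl⟩, rfl⟩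
    exact ⟨fun k => Nat.casesOn k ⟨b, hb⟩ ω, ifsPoint_eq hR B _⟩

/-- The attractor is the only non-empty compact invariant set. -/
theorem attractor_unique {R : ℝ} (hR : 1 < R) {B : Finset ℝ} {X : Set ℝ} (hX : IsCompact X)
    (hne : X.Nonempty) (hinv : X = ⋃ b ∈ B, ifsMap R b '' X) : X = attractor R B := by
  have h0 : (0 : ℝ) ≤ R⁻¹ := by positivity
  have hlim : ∀ C : ℝ, Filter.Tendsto (fun n : ℕ => R⁻¹ ^ n * C) Filter.atTop (nhds 0) := by
    intro C
    simpa using (tendsto_pow_atTop_nhds_zero_of_lt_one h0 (inv_lt_one_of_one_lt₀ hR)).mul_const C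
  have hcl : IsClosed (attractor R B) :=
    (isCompact_range (continuous_ifsPoint hR B)).isClosed
  obtain ⟨C, hC⟩ : ∃ C, ∀ x ∈ X, ∀ y ∈ attractor R B, |x - y| ≤ C := by
    have hb := (hX.union (isCompact_range (continuous_ifsPoint hR B))).isBounded
    obtain ⟨C, hC⟩ := Metric.isBounded_iff.1 hb
    exact ⟨C, fun x hx y hy => hC (Or.inl hx) (Or.inr hy)⟩
  have hmem : ∀ x ∈ X, ∃ b ∈ B, ∃ y ∈ X, ifsMap R b y = x := by
    intro x hx
    rw [hinv] at hx
    simpa using hx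
  have hmap : ∀ b ∈ B, ∀ x ∈ X, ifsMap R b x ∈ X := by
    intro b hb x hx
    rw [hinv]
    simp only [Set.mem_iUnion]
    exact ⟨b, hb, x, hx, rfl⟩
  have hBne : B.Nonempty := by
    obtain ⟨x, hx⟩ := hne
    obtain ⟨b, hb, -⟩ := hmem x hx
    exact ⟨b, hb⟩
  obtain ⟨-, ⟨z, hz⟩, hAinv⟩ := attractor_spec hR hBne
  have hAmap : ∀ b ∈ B, ∀ x ∈ attractor R B, ifsMap R b x ∈ attractor R B := by
    intro b hb x hx
    rw [hAinv]
    simp only [Set.mem_iUnion]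
    exact ⟨b, hb, x, hx, rfl⟩
  have hAmem : ∀ x ∈ attractor R B, ∃ b ∈ B, ∃ y ∈ attractor R B, ifsMap R b y = x := by
    intro x hx
    rw [hAinv] at hx
    simpa using hx
  obtain ⟨x₀, hx₀⟩ := hne
  have key1 : ∀ n : ℕ, ∀ x ∈ X, ∃ y ∈ attractor R B, |x - y| ≤ R⁻¹ ^ n * C := by
    intro n
    induction n with
    | zero => exact fun x hx => ⟨z, hz, by simpa using hC x hx z hz⟩
    | succ n ih =>
      intro x hx
      obtain ⟨b, hb, y, hy, rfl⟩ := hmem x hx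
      obtain ⟨u, hu, huy⟩ := ih y hy
      refine ⟨_, hAmap b hb u hu, ?_⟩
      rw [dist_ifsMap hR, pow_succ', mul_assoc]
      gcongr
  have key2 : ∀ n : ℕ, ∀ y ∈ attractor R B, ∃ x ∈ X, |x - y| ≤ R⁻¹ ^ n * C := by
    intro n
    induction n with
    | zero => exact fun y hy => ⟨x₀, hx₀, by simpa using hC x₀ hx₀ y hy⟩
    | succ n ih =>
      intro x hx
      obtain ⟨b, hb, y, hy, rfl⟩ := hAmem x hx
      obtain ⟨u, hu, huy⟩ := ih y hy
      refine ⟨_, hmap b hb u hu, ?_⟩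
      rw [dist_ifsMap hR, pow_succ', mul_assoc]
      gcongr
  apply Set.Subset.antisymm
  · intro x hx
    choose y hy hxy using fun n => key1 n x hx
    refine hcl.mem_of_tendsto (f := y) (b := Filter.atTop) ?_ (Filter.Eventually.of_forall hy)
    rw [tendsto_iff_dist_tendsto_zero]
    exact squeeze_zero (fun _ => dist_nonneg)
      (fun n => by rw [dist_comm]; exact hxy n) (hlim C)
  · intro y hy
    choose x hx hxy using fun n => key2 n y hy
    refine hX.isClosed.mem_of_tendsto (f := x) (b := Filter.atTop) ?_
      (Filter.Eventually.of_forall hx)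
    rw [tendsto_iff_dist_tendsto_zero]
    exact squeeze_zero (fun _ => dist_nonneg) (fun n => hxy n) (hlim C)

/-- The law of the digit sequence `(b, ω)` with `b` and `ω` independent. -/
theorem map_cons_infinitePi {α : Type*} [MeasurableSpace α] (ν : Measure α)
    [IsProbabilityMeasure ν] :
    (ν.prod (Measure.infinitePi fun _ : ℕ => ν)).map
      (fun p : α × (ℕ → α) => fun k : ℕ => Nat.casesOn k p.1 p.2) =
      Measure.infinitePi fun _ : ℕ => ν := by
  have hmeas : Measurable
      (fun p : α × (ℕ → α) => (fun k : ℕ => Nat.casesOn k p.1 p.2 : ℕ → α)) := by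
    rw [measurable_pi_iff]
    rintro (_ | k)
    · exact measurable_fst
    · exact (measurable_pi_apply k).comp measurable_snd
  apply Measure.eq_infinitePi
  intro s t ht
  rw [Measure.map_apply hmeas (MeasurableSet.pi s.countable_toSet fun i _ => ht i)]
  classical
  set s' : Finset ℕ := s.preimage Nat.succ (Nat.succ_injective.injOn) with hs'
  set t0 : Set α := if 0 ∈ s then t 0 else Set.univ with ht0
  have hset : (fun p : α × (ℕ → α) => (fun k : ℕ => Nat.casesOn k p.1 p.2 : ℕ → α)) ⁻¹'
      (Set.pi s t) = t0 ×ˢ Set.pi s' (fun k => t (k + 1)) := by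
    ext ⟨b, ω⟩
    simp only [Set.mem_preimage, Set.mem_pi, Set.mem_prod, hs', ht0, Finset.mem_coe,
      Finset.mem_preimage]
    constructor
    · intro h
      refine ⟨?_, fun k hk => h (k + 1) hk⟩
      split_ifs with h0
      · exact h 0 h0
      · trivial
    · rintro ⟨h0, h1⟩ (_ | k) hk
      · simpa [hk] using h0
      · exact h1 k hk
  rw [hset, Measure.prod_prod, Measure.infinitePi_pi _ fun i _ => ht (i + 1)]
  have h1 : ∏ i ∈ s', ν (t (i + 1)) = ∏ i ∈ s.erase 0, ν (t i) := by
    refine Finset.prod_bij (fun i _ => i + 1) ?_ ?_ ?_ ?_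
    · intro a ha
      simpa [hs'] using ha
    · intro a _ b _ h
      simpa using h
    · rintro (_ | b) hb
      · simp at hb
      · exact ⟨b, by simpa [hs'] using hb, rfl⟩
    · intro a _
      rfl
  rw [h1, ht0]
  split_ifs with h0
  · exact Finset.mul_prod_erase s (fun i => ν (t i)) h0
  · simp [Finset.erase_eq_of_notMem h0]

theorem exists_isInvariantMeasure {R : ℝ} (hR : 1 < R) {B : Finset ℝ} (hB : B.Nonempty) :
    ∃ μ, IsInvariantMeasure R B μ := by
  have : Nonempty B := hB.to_subtype
  let ν : Measure B := ProbabilityTheory.uniformOn Set.univ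
  have : IsProbabilityMeasure ν :=
    ProbabilityTheory.isProbabilityMeasure_uniformOn Set.finite_univ Set.univ_nonempty
  let P : Measure (ℕ → B) := Measure.infinitePi fun _ => ν
  have hc := continuous_ifsPoint hR B
  refine ⟨P.map (ifsPoint R B), Measure.isProbabilityMeasure_map hc.aemeasurable, ?_⟩
  intro f hf hfs
  have hmeas : Measurable
      (fun p : B × (ℕ → B) => (fun k : ℕ => Nat.casesOn k p.1 p.2 : ℕ → B)) := by
    rw [measurable_pi_iff]
    rintro (_ | k)
    · exact measurable_fst
    · exact (measurable_pi_apply k).comp measurable_snd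
  have hτ : ∀ b, Continuous (ifsMap R b) := fun b => by unfold ifsMap; fun_prop
  have hint : Integrable (fun p : B × (ℕ → B) => f (ifsMap R p.1 (ifsPoint R B p.2)))
      (ν.prod P) := by
    obtain ⟨C, hC⟩ := hfs.exists_bound_of_continuous hf
    refine Integrable.of_bound (Continuous.aestronglyMeasurable ?_) C
      (Filter.Eventually.of_forall fun p => hC _)
    unfold ifsMap
    fun_prop
  rw [integral_map hc.aemeasurable hf.aestronglyMeasurable]
  conv_lhs => rw [show P = _ from (map_cons_infinitePi ν).symm]
  rw [integral_map (f := fun ω => f (ifsPoint R B ω)) hmeas.aemeasurable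
    (hf.comp hc).aestronglyMeasurable]
  have hpt : ∀ p : B × (ℕ → B), f (ifsPoint R B fun k : ℕ => Nat.casesOn k p.1 p.2) =
      f (ifsMap R p.1 (ifsPoint R B p.2)) := fun p => congrArg f (ifsPoint_eq hR B _)
  rw [integral_congr_ae (Filter.Eventually.of_forall hpt), integral_prod _ hint, integral_fintype Integrable.of_finite]
  have hν : ∀ b : B, ν.real {b} = (B.card : ℝ)⁻¹ := by
    intro b
    simp [ν, Measure.real, ProbabilityTheory.uniformOn_univ]
  simp only [hν, smul_eq_mul, ← Finset.mul_sum]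
  congr 1
  rw [← Finset.sum_coe_sort B]
  refine Finset.sum_congr rfl fun b _ => ?_
  exact (integral_map hc.aemeasurable (hf.comp (hτ b)).aestronglyMeasurable).symm

theorem IsInvariantMeasure.eq_sum_map {R : ℝ} {B : Finset ℝ} {μ : Measure ℝ}
    (hμ : IsInvariantMeasure R B μ) :
    μ = (B.card : ℝ≥0∞)⁻¹ • ∑ b ∈ B, μ.map (ifsMap R b) := by
  have := hμ.isProbabilityMeasure
  have hτ : ∀ b, Continuous (ifsMap R b) := fun b => by unfold ifsMap; fun_prop
  have hne : B.Nonempty := by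
    by_contra h
    rw [Finset.not_nonempty_iff_eq_empty] at h
    have h0 : μ = 0 := by
      refine Measure.ext_of_integral_eq_on_compactlySupported fun f => ?_
      simpa [h] using hμ.integral_eq f f.continuous f.hasCompactSupport
    exact (IsProbabilityMeasure.ne_zero μ) h0
  have hfin : (B.card : ℝ≥0∞)⁻¹ ≠ ∞ := by simp [hne.ne_empty]
  have : ∀ b ∈ B, IsFiniteMeasure (μ.map (ifsMap R b)) := fun b _ => inferInstance
  have hsum : IsFiniteMeasure (∑ b ∈ B, μ.map (ifsMap R b)) := inferInstance
  have : IsFiniteMeasure ((B.card : ℝ≥0∞)⁻¹ • ∑ b ∈ B, μ.map (ifsMap R b)) :=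
    Measure.smul_finite _ hfin
  refine Measure.ext_of_integral_eq_on_compactlySupported fun f => ?_
  rw [hμ.integral_eq f f.continuous f.hasCompactSupport, integral_smul_measure,
    integral_finsetSum_measure]
  · simp only [ENNReal.toReal_inv, ENNReal.toReal_natCast, smul_eq_mul]
    congr 1
    refine Finset.sum_congr rfl fun b _ => ?_
    exact (integral_map (hτ b).aemeasurable f.continuous.aestronglyMeasurable).symm
  · exact fun b _ => f.continuous.integrable_of_hasCompactSupport f.hasCompactSupport

theorem IsInvariantMeasure.charFun_eq {R : ℝ} {B : Finset ℝ} {μ : Measure ℝ}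
    (hμ : IsInvariantMeasure R B μ) (t : ℝ) :
    charFun μ t = ((B.card : ℂ)⁻¹ * ∑ b ∈ B, Complex.exp (R⁻¹ * b * t * Complex.I)) *
      charFun μ (R⁻¹ * t) := by
  have := hμ.isProbabilityMeasure
  have hτ : ∀ b, Continuous (ifsMap R b) := fun b => by unfold ifsMap; fun_prop
  conv_lhs => rw [hμ.eq_sum_map]
  rw [charFun_apply_real, integral_smul_measure, integral_finsetSum_measure]
  · simp only [ENNReal.toReal_inv, ENNReal.toReal_natCast, Complex.real_smul]
    push_cast
    rw [mul_assoc, Finset.sum_mul]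
    congr 1
    refine Finset.sum_congr rfl fun b _ => ?_
    rw [integral_map (hτ b).aemeasurable (by fun_prop), charFun_apply_real, ← integral_const_mul]
    congr 1
    ext x
    rw [← Complex.exp_add]
    unfold ifsMap
    congr 1
    push_cast
    ring
  · intro b _
    refine Integrable.of_bound (by fun_prop) 1 (Filter.Eventually.of_forall fun x => ?_)
    rw [← Complex.ofReal_mul, Complex.norm_exp_ofReal_mul_I]

/-- For `R > 1` and `B` non-empty there is exactly one invariant measure. -/
theorem existsUnique_isInvariantMeasure {R : ℝ} (hR : 1 < R) {B : Finset ℝ} (hB : B.Nonempty) :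
    ∃! μ, IsInvariantMeasure R B μ := by
  obtain ⟨μ, hμ⟩ := exists_isInvariantMeasure hR hB
  refine ⟨μ, hμ, fun μ' hμ' => ?_⟩
  have := hμ.isProbabilityMeasure
  have := hμ'.isProbabilityMeasure
  refine Measure.ext_of_charFun (funext fun t => ?_)
  have hstep : ∀ s : ℝ, ‖charFun μ' s - charFun μ s‖ ≤
      ‖charFun μ' (R⁻¹ * s) - charFun μ (R⁻¹ * s)‖ := by
    intro s
    rw [hμ'.charFun_eq, hμ.charFun_eq, ← mul_sub, norm_mul]
    refine mul_le_of_le_one_left (norm_nonneg _) ?_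
    rw [norm_mul, norm_inv, Complex.norm_natCast]
    have hsum : ‖∑ b ∈ B, Complex.exp (R⁻¹ * b * s * Complex.I)‖ ≤ B.card := by
      refine (norm_sum_le _ _).trans ?_
      have : ∀ b ∈ B, ‖Complex.exp (R⁻¹ * b * s * Complex.I)‖ = 1 := by
        intro b _
        rw [← Complex.ofReal_mul, ← Complex.ofReal_mul, Complex.norm_exp_ofReal_mul_I]
      rw [Finset.sum_congr rfl this]
      simp
    have hpos : (0 : ℝ) < B.card := by exact_mod_cast hB.card_pos
    rw [inv_mul_le_iff₀ hpos]
    simpa using hsum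
  have hiter : ∀ n : ℕ, ‖charFun μ' t - charFun μ t‖ ≤
      ‖charFun μ' (R⁻¹ ^ n * t) - charFun μ (R⁻¹ ^ n * t)‖ := by
    intro n
    induction n with
    | zero => simp
    | succ n ih =>
      refine ih.trans ((hstep _).trans_eq ?_)
      rw [pow_succ', mul_assoc]
  have hlim : Filter.Tendsto (fun n : ℕ => R⁻¹ ^ n * t) Filter.atTop (nhds 0) := by
    simpa using (tendsto_pow_atTop_nhds_zero_of_lt_one (by positivity : (0 : ℝ) ≤ R⁻¹)
      (inv_lt_one_of_one_lt₀ hR)).mul_const t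
  have hcont : Continuous fun s : ℝ => ‖charFun μ' s - charFun μ s‖ :=
    (continuous_charFun.sub continuous_charFun).norm
  have hlim' := (hcont.tendsto 0).comp hlim
  simp only [charFun_zero, probReal_univ, sub_self, norm_zero] at hlim'
  have := ge_of_tendsto' hlim' hiter
  exact sub_eq_zero.1 (norm_le_zero_iff.1 this)

end

end CuntzBasis

/-! Let Γ = `dualPeriods B` be the group of all t with bt ∈ ℤ for every b ∈ B. It contains ℤ, is
stable under multiplication by R, and consists of periods of m_B. A mean of unit numbers, one of
them equal to 1, has modulus 1 only if all equal 1, so extreme cycle points lie in Γ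
(`mem_dualPeriods_of_norm_maskFun`). For t ∈ Γ one has e_t(Rx - b) = e_t(Rx), hence S_l e_t =
e_{l+Rt} on the attractor (`cuntzWord_expFun`). The family thus consists of the e_λ with λ in Λ =
`cycleFreq R B L`, and (l, s) ↦ l + Rs is a bijection L × Λ → Λ (`bijective_add_mul`).

Write μ̂(t) = ∫ e_t dμ. Self-similarity gives μ̂(Rt) = m_B(t) μ̂(t) (`integral_expFun_mul`), and the
spectrum condition gives m_B((l' - l)/R) = 0 for distinct letters. Cancelling common leading letters
of two distinct frequencies therefore yields orthogonality.

For completeness let P be the projection onto the closed span and h(x) = ‖P e_{-x}‖² = ∑_λ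
|μ̂(-x-λ)|². The bijection and the equation for μ̂ give h(x) = ∑_l |m_B((x+l)/R)|² h((x+l)/R), with
weights of sum 1, so g = 1 - h is harmonic for a random walk. It is real-analytic because μ has
compact support, and it vanishes at extreme cycle points. The points where g attains its maximum on
an invariant interval form a set closed under transitions of positive weight (`nonpos_of_harmonic`).
If this set is infinite, g is constant, equal to g(0) = 0. If it is finite, counting paths produces
an extreme cycle inside it (`exists_forced_subset`, `exists_isExtremeCyclePoint`). Either way g ≤ 0,
so every e_t lies in the closed span, and the exponentials are total in L²(μ). -/

namespace CuntzBasis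

/-! ### Exponentials -/

theorem expFun_comm (t x : ℝ) : expFun t x = expFun x t := by
  unfold expFun; congr 1; ring

theorem expFun_add (s t x : ℝ) : expFun (s + t) x = expFun s x * expFun t x := by
  unfold expFun; rw [← Complex.exp_add]; congr 1; push_cast; ring

theorem expFun_add_right (t x y : ℝ) : expFun t (x + y) = expFun t x * expFun t y := by
  simp only [expFun_comm t, expFun_add]

theorem expFun_zero (x : ℝ) : expFun 0 x = 1 := by simp [expFun]

theorem expFun_zero_right (t : ℝ) : expFun t 0 = 1 := by simp [expFun]

theorem expFun_eq_exp_ofReal (t x : ℝ) :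
    expFun t x = Complex.exp ((2 * Real.pi * t * x : ℝ) * Complex.I) := by
  unfold expFun; congr 1; push_cast; ring

theorem norm_expFun (t x : ℝ) : ‖expFun t x‖ = 1 := by
  rw [expFun_eq_exp_ofReal, Complex.norm_exp_ofReal_mul_I]

theorem conj_expFun (t x : ℝ) : (starRingEnd ℂ) (expFun t x) = expFun (-t) x := by
  rw [expFun_eq_exp_ofReal, expFun_eq_exp_ofReal, ← Complex.exp_conj, map_mul, Complex.conj_ofReal,
    Complex.conj_I]
  congr 1
  push_cast
  ring

theorem expFun_neg (t x : ℝ) : expFun (-t) x = (expFun t x)⁻¹ := by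
  rw [← conj_expFun, Complex.inv_def, Complex.normSq_eq_norm_sq, norm_expFun]; simp

theorem continuous_expFun (t : ℝ) : Continuous (expFun t) := by
  unfold expFun; fun_prop

theorem expFun_eq_one_iff (t x : ℝ) : expFun t x = 1 ↔ ∃ n : ℤ, t * x = n := by
  unfold expFun
  rw [Complex.exp_eq_one_iff]
  refine exists_congr fun n => ?_
  have h : (2 * Real.pi * Complex.I : ℂ) ≠ 0 := Complex.two_pi_I_ne_zero
  constructor
  · intro h1
    have h2 : (t * x : ℂ) = n := by
      apply mul_left_cancel₀ h
      linear_combination h1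
    exact_mod_cast h2
  · intro h1
    have h2 : (t * x : ℂ) = n := by exact_mod_cast h1
    linear_combination (2 * Real.pi * Complex.I) * h2

/-! ### The mask and its periods -/

/-- The additive group of the `t` with `b t ∈ ℤ` for all `b ∈ B`. -/
def dualPeriods (B : Finset ℝ) : AddSubgroup ℝ where
  carrier := {t | ∀ b ∈ B, ∃ n : ℤ, b * t = n}
  zero_mem' b _ := ⟨0, by simp⟩
  add_mem' {s t} hs ht b hb := by
    obtain ⟨m, hm⟩ := hs b hb
    obtain ⟨n, hn⟩ := ht b hb
    exact ⟨m + n, by push_cast; rw [mul_add, hm, hn]⟩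
  neg_mem' {s} hs b hb := by
    obtain ⟨m, hm⟩ := hs b hb
    exact ⟨-m, by push_cast; rw [mul_neg, hm]⟩

theorem expFun_of_mem_dualPeriods {B : Finset ℝ} {t b : ℝ} (ht : t ∈ dualPeriods B) (hb : b ∈ B) :
    expFun b t = 1 :=
  (expFun_eq_one_iff b t).2 (ht b hb)

theorem int_mul_mem_dualPeriods {B : Finset ℝ} {t R : ℝ} (hR : R ∈ Set.range ((↑) : ℤ → ℝ))
    (ht : t ∈ dualPeriods B) : R * t ∈ dualPeriods B := by
  obtain ⟨r, rfl⟩ := hR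
  simpa using (dualPeriods B).zsmul_mem ht r

theorem int_mem_dualPeriods {B : Finset ℝ} (hB : (B : Set ℝ) ⊆ Set.range ((↑) : ℤ → ℝ)) {l : ℝ}
    (hl : l ∈ Set.range ((↑) : ℤ → ℝ)) : l ∈ dualPeriods B := by
  intro b hb
  obtain ⟨m, rfl⟩ := hB hb
  obtain ⟨n, rfl⟩ := hl
  exact ⟨m * n, by push_cast; rfl⟩

theorem maskFun_zero {B : Finset ℝ} (hB : B.Nonempty) : maskFun B 0 = 1 := by
  have : (B.card : ℂ) ≠ 0 := by exact_mod_cast hB.card_pos.ne'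
  simp [maskFun, expFun_zero_right, this]

theorem maskFun_add_of_mem {B : Finset ℝ} {s : ℝ} (hs : s ∈ dualPeriods B) (x : ℝ) :
    maskFun B (x + s) = maskFun B x := by
  unfold maskFun
  congr 1
  refine Finset.sum_congr rfl fun b hb => ?_
  rw [expFun_add_right, expFun_of_mem_dualPeriods hs hb, mul_one]

/-- Equality case of the triangle inequality: |1 + u|² = 2 + 2 Re u forces Re u = 1. -/
theorem eq_one_of_norm_one_add {u : ℂ} (hu : ‖u‖ = 1) (h : 2 ≤ ‖1 + u‖) : u = 1 := by
  have h1 : u.re * u.re + u.im * u.im = 1 := by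
    rw [← Complex.normSq_apply, Complex.normSq_eq_norm_sq, hu]; norm_num
  have h2 : (1 + u.re) * (1 + u.re) + u.im * u.im = ‖1 + u‖ ^ 2 := by
    rw [← Complex.normSq_eq_norm_sq, Complex.normSq_apply]; simp
  have h3 : u.re = 1 := by nlinarith
  have h4 : u.im = 0 := by
    rw [h3] at h1
    simpa using h1
  exact Complex.ext h3 h4

/-- If the mean of unit vectors has norm one and one of them is `1`, all of them are. -/
theorem mem_dualPeriods_of_norm_maskFun {B : Finset ℝ} (hB0 : (0 : ℝ) ∈ B) {x : ℝ}
    (h : ‖maskFun B x‖ = 1) : x ∈ dualPeriods B := by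
  classical
  intro b hb
  rw [← expFun_eq_one_iff]
  by_cases hb0 : b = 0
  · rw [hb0, expFun_zero]
  have hpos : (0 : ℝ) < B.card := by exact_mod_cast Finset.card_pos.2 ⟨b, hb⟩
  have hsum : ‖∑ b ∈ B, expFun b x‖ = B.card := by
    unfold maskFun at h
    rw [norm_mul, norm_inv, Complex.norm_natCast] at h
    field_simp at h
    exact h
  have hb' : b ∈ B.erase 0 := Finset.mem_erase.2 ⟨hb0, hb⟩
  -- Split off the terms of 0 and b. The other N - 2 have total modulus at most N - 2, which leaves
  -- |1 + e_b(x)| ≥ 2.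
  rw [← Finset.add_sum_erase B _ hB0, ← Finset.add_sum_erase _ _ hb', expFun_zero,
    ← add_assoc] at hsum
  apply eq_one_of_norm_one_add (norm_expFun b x)
  have h1 := norm_add_le (1 + expFun b x) (∑ i ∈ (B.erase 0).erase b, expFun i x)
  have h2 : ‖∑ i ∈ (B.erase 0).erase b, expFun i x‖ ≤ (((B.erase 0).erase b).card : ℝ) := by
    refine (norm_sum_le _ _).trans ?_
    simp [norm_expFun]
  have h3 : (((B.erase 0).erase b).card : ℝ) + 2 = B.card := by
    have e1 := Finset.card_erase_add_one hb'
    have e2 := Finset.card_erase_add_one hB0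
    exact_mod_cast (by omega : ((B.erase 0).erase b).card + 2 = B.card)
  linarith

/-! ### Consequences of the spectrum condition -/

theorem image_inv_mul_injective {R : ℝ} (hR : 1 < R) :
    Function.Injective fun b : ℝ => R⁻¹ * b :=
  mul_right_injective₀ (by positivity)

theorem card_image_inv_mul {R : ℝ} (hR : 1 < R) (B : Finset ℝ) :
    (B.image fun b => R⁻¹ * b).card = B.card :=
  Finset.card_image_of_injective B (image_inv_mul_injective hR)

theorem inv_sqrt_mul_self (n : ℕ) : ((√(n : ℝ) : ℝ) : ℂ)⁻¹ * ((√(n : ℝ) : ℝ) : ℂ)⁻¹ = (n : ℂ)⁻¹ := by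
  rw [← mul_inv, ← Complex.ofReal_mul, Real.mul_self_sqrt n.cast_nonneg, Complex.ofReal_natCast]

/-- The value of m_B here is the inner product of two distinct columns of the unitary matrix. -/
theorem maskFun_eq_zero_of_isSpectrum {R : ℝ} (hR : 1 < R) {B L : Finset ℝ}
    (h : IsSpectrum (B.image fun b => R⁻¹ * b) L) {l l' : ℝ} (hl : l ∈ L) (hl' : l' ∈ L)
    (hne : l ≠ l') : maskFun B ((l' - l) / R) = 0 := by
  obtain ⟨-, -, h2⟩ := h
  have h3 := congrFun (congrFun h2 ⟨l, hl⟩) ⟨l', hl'⟩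
  rw [Matrix.one_apply_ne (by simpa using hne), Matrix.mul_apply] at h3
  rw [← h3, maskFun, Finset.mul_sum]
  have h4 : ∀ j : (B.image fun b => R⁻¹ * b : Finset ℝ),
      (B.card : ℂ)⁻¹ * expFun j (l' - l) =
      (((√((B.image fun b => R⁻¹ * b).card : ℝ))⁻¹ : ℂ) * expFun j l') *
      star (((√((B.image fun b => R⁻¹ * b).card : ℝ))⁻¹ : ℂ) * expFun j l) := by
    intro j
    rw [card_image_inv_mul hR, ← inv_sqrt_mul_self, sub_eq_add_neg, expFun_add_right,
      expFun_comm _ (-l), ← conj_expFun, expFun_comm l]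
    simp only [star_mul', Complex.star_def, map_inv₀, Complex.conj_ofReal]
    ring
  simp only [Matrix.conjTranspose_apply, Matrix.of_apply]
  rw [Finset.sum_congr rfl fun j _ => (mul_comm _ _).trans (h4 j).symm,
    Finset.sum_coe_sort (B.image fun b => R⁻¹ * b) fun a => (B.card : ℂ)⁻¹ * expFun a (l' - l),
    Finset.sum_image (image_inv_mul_injective hR).injOn]
  refine Finset.sum_congr rfl fun b _ => ?_
  congr 1
  unfold expFun
  congr 1
  push_cast
  ring

/-- Orthonormality of the rows of the unitary matrix. -/
theorem sum_expFun_of_isSpectrum {R : ℝ} (hR : 1 < R) {B L : Finset ℝ}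
    (h : IsSpectrum (B.image fun b => R⁻¹ * b) L) {b b' : ℝ} (hb : b ∈ B) (hb' : b' ∈ B) :
    (B.card : ℂ)⁻¹ * ∑ l ∈ L, expFun (b - b') (l / R) = if b = b' then 1 else 0 := by
  obtain ⟨-, h1, -⟩ := h
  have hm : ∀ {c}, c ∈ B → R⁻¹ * c ∈ B.image fun b => R⁻¹ * b :=
    fun hc => Finset.mem_image_of_mem _ hc
  have h3 := congrFun (congrFun h1 ⟨_, hm hb⟩) ⟨_, hm hb'⟩
  have hiff : ((⟨_, hm hb⟩ : (B.image fun b => R⁻¹ * b : Finset ℝ)) = ⟨_, hm hb'⟩) ↔ b = b' := by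
    rw [Subtype.mk.injEq]
    exact (image_inv_mul_injective hR).eq_iff
  rw [Matrix.one_apply, Matrix.mul_apply] at h3
  simp only [hiff] at h3
  rw [← h3]
  simp only [Matrix.conjTranspose_apply, Matrix.of_apply]
  rw [Finset.mul_sum, ← Finset.sum_coe_sort L]
  refine Finset.sum_congr rfl fun l _ => ?_
  have e1 : expFun (b - b') (l / R) = expFun (R⁻¹ * b) l * expFun (-(R⁻¹ * b')) l := by
    rw [← expFun_add]
    unfold expFun
    congr 1
    push_cast
    ring
  rw [e1, ← conj_expFun, card_image_inv_mul hR, ← inv_sqrt_mul_self]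
  simp only [star_mul', Complex.star_def, map_inv₀, Complex.conj_ofReal]
  ring

/-- Expand |m_B|² as a double sum over b, b'. The shift by t only contributes a phase, and summing
over l kills the off-diagonal terms. The squares thus become transition probabilities of x ↦ (x +
l)/R. -/
theorem sum_norm_maskFun_sq {R : ℝ} (hR : 1 < R) {B L : Finset ℝ} (hB : B.Nonempty)
    (h : IsSpectrum (B.image fun b => R⁻¹ * b) L) (t : ℝ) :
    ∑ l ∈ L, ‖maskFun B ((t + l) / R)‖ ^ 2 = 1 := by
  have hN : (B.card : ℂ) ≠ 0 := by exact_mod_cast hB.card_pos.ne'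
  have e1 : ∀ x : ℝ, ((‖maskFun B x‖ ^ 2 : ℝ) : ℂ) =
      (B.card : ℂ)⁻¹ * ((B.card : ℂ)⁻¹ * ∑ b ∈ B, ∑ b' ∈ B, expFun (b - b') x) := by
    intro x
    rw [Complex.ofReal_pow, ← Complex.mul_conj']
    unfold maskFun
    rw [map_mul, map_inv₀, Complex.conj_natCast, map_sum, mul_mul_mul_comm, Finset.sum_mul_sum,
      mul_assoc]
    simp only [conj_expFun, ← expFun_add, sub_eq_add_neg]
  have e2 : ((∑ l ∈ L, ‖maskFun B ((t + l) / R)‖ ^ 2 : ℝ) : ℂ) = 1 := by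
    rw [Complex.ofReal_sum]
    simp only [e1]
    rw [← Finset.mul_sum, ← Finset.mul_sum, Finset.sum_comm]
    have e3 : ∀ b ∈ B, ∑ l ∈ L, ∑ b' ∈ B, expFun (b - b') ((t + l) / R) = B.card := by
      intro b hb
      rw [Finset.sum_comm]
      have e4 : ∀ b' ∈ B, ∑ l ∈ L, expFun (b - b') ((t + l) / R) = if b = b' then (B.card : ℂ) else 0 := by
        intro b' hb'
        simp only [add_div, expFun_add_right]
        rw [← Finset.mul_sum]
        have h4 := sum_expFun_of_isSpectrum hR h hb hb'
        rw [inv_mul_eq_iff_eq_mul₀ hN] at h4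
        rw [h4]
        split_ifs with hbb
        · simp [hbb, expFun_zero]
        · simp
      rw [Finset.sum_congr rfl e4, Finset.sum_ite_eq, if_pos hb]
    rw [Finset.sum_congr rfl e3, Finset.sum_const, nsmul_eq_mul]
    field_simp
  exact_mod_cast e2

/-- Distinct letters are incongruent modulo R: otherwise the vanishing value of m_B would be m_B(k)
= m_B(0) = 1. -/
theorem not_dvd_sub_of_isSpectrum {R : ℝ} (hR : 1 < R) {B L : Finset ℝ} (hB : B.Nonempty)
    (hBint : (B : Set ℝ) ⊆ Set.range ((↑) : ℤ → ℝ))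
    (h : IsSpectrum (B.image fun b => R⁻¹ * b) L) {l l' : ℝ} (hl : l ∈ L) (hl' : l' ∈ L) (k : ℤ)
    (hk : l' - l = k * R) : l = l' := by
  by_contra hne
  have h1 := maskFun_eq_zero_of_isSpectrum hR h hl hl' hne
  rw [hk, mul_div_cancel_right₀ _ (by positivity), ← zero_add (k : ℝ),
    maskFun_add_of_mem (int_mem_dualPeriods hBint ⟨k, rfl⟩), maskFun_zero hB] at h1
  exact one_ne_zero h1

noncomputable section

/-! ### Finite invariant sets contain extreme cycles -/

/-- The letters `l` for which the transition `x ↦ (x + l) / R` has positive weight. -/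
def admissible (R : ℝ) (B L : Finset ℝ) (x : ℝ) : Finset ℝ :=
  open Classical in L.filter fun l => maskFun B ((x + l) / R) ≠ 0

/-- The end points of the admissible paths of length `n` that start at `x`. -/
def pathEnds (R : ℝ) (B L : Finset ℝ) : ℕ → ℝ → Finset ℝ
  | 0, x => {x}
  | n + 1, x => open Classical in
    (admissible R B L x).biUnion fun l => pathEnds R B L n ((x + l) / R)

variable {R : ℝ} {B L : Finset ℝ}

theorem mem_admissible {x l : ℝ} :
    l ∈ admissible R B L x ↔ l ∈ L ∧ maskFun B ((x + l) / R) ≠ 0 := by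
  simp [admissible]

/-- An end point remembers its starting point modulo ℤ; this is what makes the first letter of a
path recoverable. -/
theorem exists_int_of_mem_pathEnds (hR : 1 < R) (hRint : R ∈ Set.range ((↑) : ℤ → ℝ))
    (hLint : (L : Set ℝ) ⊆ Set.range ((↑) : ℤ → ℝ)) (n : ℕ) :
    ∀ x, ∀ y ∈ pathEnds R B L n x, ∃ k : ℤ, R ^ n * y = x + k := by
  induction n with
  | zero =>
    intro x y hy
    exact ⟨0, by simpa [pathEnds] using hy⟩
  | succ n ih =>
    intro x y hy
    simp only [pathEnds, Finset.mem_biUnion] at hy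
    obtain ⟨l, hl, hy⟩ := hy
    obtain ⟨k, hk⟩ := ih _ _ hy
    obtain ⟨r, hr⟩ := hRint
    obtain ⟨m, hm⟩ := hLint (mem_admissible.1 hl).1
    refine ⟨m + r * k, ?_⟩
    have hR0 : R ≠ 0 := by positivity
    push_cast
    rw [hm, hr, pow_succ', mul_assoc, hk]
    field_simp
    ring

/-- Two paths from x with a common end point have first letters congruent modulo R, hence equal. The
union over first letters is therefore disjoint. -/
theorem card_pathEnds_succ (hR : 1 < R) (hRint : R ∈ Set.range ((↑) : ℤ → ℝ))
    (hLint : (L : Set ℝ) ⊆ Set.range ((↑) : ℤ → ℝ))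
    (hinc : ∀ l ∈ L, ∀ l' ∈ L, ∀ k : ℤ, l' - l = k * R → l = l') (n : ℕ) (x : ℝ) :
    (pathEnds R B L (n + 1) x).card =
      ∑ l ∈ admissible R B L x, (pathEnds R B L n ((x + l) / R)).card := by
  classical
  simp only [pathEnds]
  rw [Finset.card_biUnion]
  intro l hl l' hl' hne
  rw [Function.onFun, Finset.disjoint_left]
  intro y hy hy'
  obtain ⟨k, hk⟩ := exists_int_of_mem_pathEnds hR hRint hLint n _ _ hy
  obtain ⟨k', hk'⟩ := exists_int_of_mem_pathEnds hR hRint hLint n _ _ hy'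
  refine hne (hinc l (mem_admissible.1 hl).1 l' (mem_admissible.1 hl').1 (k - k') ?_)
  have hR0 : R ≠ 0 := by positivity
  have h := hk.symm.trans hk'
  field_simp at h
  push_cast
  linarith

theorem pathEnds_subset {Z : Finset ℝ}
    (hinv : ∀ x ∈ Z, ∀ l ∈ L, maskFun B ((x + l) / R) ≠ 0 → (x + l) / R ∈ Z) (n : ℕ) :
    ∀ x ∈ Z, pathEnds R B L n x ⊆ Z := by
  induction n with
  | zero => simp [pathEnds]
  | succ n ih =>
    intro x hx
    simp only [pathEnds, Finset.biUnion_subset]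
    intro l hl
    obtain ⟨h1, h2⟩ := mem_admissible.1 hl
    exact ih _ (hinv x hx l h1 h2)

/-- A sequence of vectors of natural numbers that increases and is bounded is stationary
somewhere. -/
theorem exists_stationary {α : Type*} (Z : Finset α) (a : ℕ → α → ℕ) (C : ℕ)
    (hmono : ∀ n, ∀ x ∈ Z, a n x ≤ a (n + 1) x) (hC : ∀ n, ∀ x ∈ Z, a n x ≤ C) :
    ∃ n, ∀ x ∈ Z, a (n + 1) x = a n x := by
  by_contra! hcon
  have hlt : ∀ n, ∑ x ∈ Z, a n x < ∑ x ∈ Z, a (n + 1) x := by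
    intro n
    obtain ⟨x, hx, hne⟩ := hcon n
    exact Finset.sum_lt_sum (hmono n) ⟨x, hx, lt_of_le_of_ne (hmono n x hx) (Ne.symm hne)⟩
  -- A strictly increasing sequence of naturals is at least n at index n, so index |Z|·C + 1 exceeds
  -- the bound |Z|·C.
  have hge := (strictMono_nat_of_lt_succ hlt).id_le (Z.card * C + 1)
  have hle : ∑ x ∈ Z, a (Z.card * C + 1) x ≤ Z.card * C :=
    (Finset.sum_le_card_nsmul _ _ _ (hC _)).trans_eq (by simp)
  simp only [id] at hge
  omega

/-- Let a_n(x) be the number of end points of paths of length n. It is nondecreasing in n and at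
most |Z| on Z, so a_{n+1} = a_n on Z for some n. If x minimizes a_n on Z, then a_n(x) is the sum of
a_n over the successors of x, each term being at least that minimum and positive. There is thus a
single successor; it has weight 1 and is again a minimizer. The set of minimizers is `Z'`. -/
theorem exists_forced_subset (hR : 1 < R) (hRint : R ∈ Set.range ((↑) : ℤ → ℝ))
    (hLint : (L : Set ℝ) ⊆ Set.range ((↑) : ℤ → ℝ))
    (hinc : ∀ l ∈ L, ∀ l' ∈ L, ∀ k : ℤ, l' - l = k * R → l = l')
    (hsum : ∀ x, ∑ l ∈ L, ‖maskFun B ((x + l) / R)‖ ^ 2 = 1) {Z : Finset ℝ} (hZ : Z.Nonempty)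
    (hinv : ∀ x ∈ Z, ∀ l ∈ L, maskFun B ((x + l) / R) ≠ 0 → (x + l) / R ∈ Z) :
    ∃ Z' ⊆ Z, Z'.Nonempty ∧
      ∀ x ∈ Z', ∃ l ∈ L, (x + l) / R ∈ Z' ∧ ‖maskFun B ((x + l) / R)‖ = 1 := by
  classical
  have hsum' : ∀ x, ∑ l ∈ admissible R B L x, ‖maskFun B ((x + l) / R)‖ ^ 2 = 1 := by
    intro x
    rw [← hsum x]
    refine Finset.sum_subset (fun l hl => (mem_admissible.1 hl).1) fun l hl hl' => ?_
    rw [mem_admissible, not_and, not_not] at hl'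
    simp [hl' hl]
  have hadm : ∀ x, (admissible R B L x).Nonempty := by
    intro x
    by_contra h
    have := hsum' x
    rw [Finset.not_nonempty_iff_eq_empty.1 h] at this
    simp at this
  have hcard := card_pathEnds_succ (B := B) hR hRint hLint hinc
  have hpos : ∀ n x, 1 ≤ (pathEnds R B L n x).card := by
    intro n
    induction n with
    | zero => simp [pathEnds]
    | succ n ih =>
      intro x
      obtain ⟨l, hl⟩ := hadm x
      rw [hcard]
      exact (ih _).trans (Finset.single_le_sum
        (f := fun l => (pathEnds R B L n ((x + l) / R)).card) (fun _ _ => Nat.zero_le _) hl)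
  have hmono : ∀ n x, (pathEnds R B L n x).card ≤ (pathEnds R B L (n + 1) x).card := by
    intro n
    induction n with
    | zero => intro x; simpa [pathEnds] using hpos 1 x
    | succ n ih =>
      intro x
      rw [hcard n, hcard (n + 1)]
      exact Finset.sum_le_sum fun l _ => ih _
  obtain ⟨n, hn⟩ := exists_stationary Z (fun n x => (pathEnds R B L n x).card) Z.card
    (fun n x _ => hmono n x) fun n x hx => Finset.card_le_card (pathEnds_subset hinv n x hx)
  obtain ⟨x₀, hx₀, hmin⟩ := Z.exists_min_image (fun x => (pathEnds R B L n x).card) hZ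
  refine ⟨Z.filter fun x => (pathEnds R B L n x).card = (pathEnds R B L n x₀).card,
    Finset.filter_subset _ _, ⟨x₀, by simp [hx₀]⟩, fun x hx => ?_⟩
  obtain ⟨hxZ, hxc⟩ := Finset.mem_filter.1 hx
  have hs := (hcard n x).symm.trans ((hn x hxZ).trans hxc)
  have hsucc : ∀ l ∈ admissible R B L x, (x + l) / R ∈ Z := fun l hl =>
    hinv x hxZ l (mem_admissible.1 hl).1 (mem_admissible.1 hl).2
  obtain ⟨l, hl⟩ := hadm x
  have hone : admissible R B L x = {l} := by
    refine Finset.eq_singleton_iff_unique_mem.2 ⟨hl, fun l' hl' => ?_⟩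
    by_contra hne
    have h1 : ∑ i ∈ {l', l}, (pathEnds R B L n ((x + i) / R)).card ≤
        ∑ i ∈ admissible R B L x, (pathEnds R B L n ((x + i) / R)).card := by
      refine Finset.sum_le_sum_of_subset fun i hi => ?_
      rcases Finset.mem_insert.1 hi with rfl | hi
      · exact hl'
      · rwa [Finset.mem_singleton.1 hi]
    rw [Finset.sum_pair hne, hs] at h1
    have h2 := hmin _ (hsucc l hl)
    have h3 := hpos n ((x + l') / R)
    omega
  rw [hone, Finset.sum_singleton] at hs
  have hw := hsum' x
  rw [hone, Finset.sum_singleton, pow_eq_one_iff_of_nonneg (norm_nonneg _) two_ne_zero] at hw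
  exact ⟨l, (mem_admissible.1 hl).1, Finset.mem_filter.2 ⟨hsucc l hl, hs⟩, hw⟩

theorem exists_isExtremeCyclePoint {Z : Finset ℝ} (hZ : Z.Nonempty)
    (h : ∀ x ∈ Z, ∃ l ∈ L, (x + l) / R ∈ Z ∧ ‖maskFun B ((x + l) / R)‖ = 1) :
    ∃ c ∈ Z, IsExtremeCyclePoint R B L c := by
  choose! l hlL hlZ hlm using h
  obtain ⟨x₀, hx₀⟩ := hZ
  set f : ℝ → ℝ := fun x => (x + l x) / R with hf
  have hmem : ∀ n, f^[n] x₀ ∈ Z := by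
    intro n
    induction n with
    | zero => exact hx₀
    | succ n ih => rw [Function.iterate_succ_apply']; exact hlZ _ ih
  have key : ∀ i j, i < j → f^[i] x₀ = f^[j] x₀ → ∃ c ∈ Z, IsExtremeCyclePoint R B L c := by
    intro i j hij heq
    -- The cycle starts at index i + 1, not i: the mask is known to have modulus 1 only at images
    -- under f.
    refine ⟨f^[i + 1] x₀, hmem _, j - i, fun k => l (f^[i + 1 + k] x₀), fun k => f^[i + 1 + k] x₀,
      by omega, rfl, ?_, fun k _ => ⟨hlL _ (hmem _), ?_, ?_⟩⟩
    · simp only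
      rw [show i + 1 + (j - i) = j + 1 by omega, Function.iterate_succ_apply',
        Function.iterate_succ_apply', heq]
    · simp only
      rw [← add_assoc, Function.iterate_succ_apply']
    · simp only
      rw [show i + 1 + k = i + k + 1 by omega, Function.iterate_succ_apply']
      exact hlm _ (hmem _)
  obtain ⟨i, j, hne, heq⟩ := Finite.exists_ne_map_eq_of_infinite
    fun n : ℕ => (⟨f^[n] x₀, hmem n⟩ : Z)
  rw [Subtype.mk.injEq] at heq
  rcases lt_or_gt_of_ne hne with hij | hij
  · exact key i j hij heq
  · exact key j i hij heq.symm

/-! ### The invariant measure is carried by the attractor -/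

theorem infDist_ifsMap_le {R : ℝ} (hR : 1 < R) {B : Finset ℝ} (hB : B.Nonempty) {b : ℝ}
    (hb : b ∈ B) (x : ℝ) :
    Metric.infDist (ifsMap R b x) (attractor R B) ≤ R⁻¹ * Metric.infDist x (attractor R B) := by
  obtain ⟨hcomp, hne, hinv⟩ := attractor_spec hR hB
  obtain ⟨y, hy, hxy⟩ := hcomp.exists_infDist_eq_dist hne x
  have hmem : ifsMap R b y ∈ attractor R B := by
    rw [hinv]
    simp only [Set.mem_iUnion]
    exact ⟨b, hb, y, hy, rfl⟩
  rw [hxy, Real.dist_eq, ← dist_ifsMap hR b, ← Real.dist_eq]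
  exact Metric.infDist_le_dist_of_mem hmem

/-- Each τ_b divides the distance to the attractor by at least R, so invariance bounds the measure
of {dist > r} by that of {dist > Rⁿ r} for every n. These sets decrease to the empty set. -/
theorem measure_attractor_compl {R : ℝ} (hR : 1 < R) {B : Finset ℝ} (hB : B.Nonempty)
    {μ : Measure ℝ} (hμ : IsInvariantMeasure R B μ) : μ (attractor R B)ᶜ = 0 := by
  have := hμ.isProbabilityMeasure
  obtain ⟨hcomp, hne, -⟩ := attractor_spec hR hB
  have hR0 : 0 < R := by positivity
  set E : ℝ → Set ℝ := fun r => {x | r < Metric.infDist x (attractor R B)} with hE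
  have hmeas : ∀ r, MeasurableSet (E r) := fun r =>
    (isOpen_lt continuous_const (Metric.continuous_infDist_pt _)).measurableSet
  have hstep : ∀ r, μ (E r) ≤ μ (E (R * r)) := by
    intro r
    have hN : (B.card : ℝ≥0∞) ≠ 0 := by exact_mod_cast hB.card_pos.ne'
    calc μ (E r) = (B.card : ℝ≥0∞)⁻¹ * ∑ b ∈ B, μ (ifsMap R b ⁻¹' E r) := by
          conv_lhs => rw [hμ.eq_sum_map]
          rw [Measure.smul_apply, Measure.finsetSum_apply, smul_eq_mul]
          congr 1
          refine Finset.sum_congr rfl fun b _ => Measure.map_apply ?_ (hmeas r)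
          unfold ifsMap
          fun_prop
      _ ≤ (B.card : ℝ≥0∞)⁻¹ * ∑ b ∈ B, μ (E (R * r)) := by
          gcongr with b hb
          intro x hx
          have h1 : r < R⁻¹ * Metric.infDist x (attractor R B) :=
            lt_of_lt_of_le hx (infDist_ifsMap_le hR hB hb x)
          rwa [lt_inv_mul_iff₀ hR0] at h1
      _ = μ (E (R * r)) := by
          rw [Finset.sum_const, nsmul_eq_mul, ← mul_assoc,
            ENNReal.inv_mul_cancel hN (ENNReal.natCast_ne_top _), one_mul]
  have hiter : ∀ r n, μ (E r) ≤ μ (E (R ^ n * r)) := by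
    intro r n
    induction n with
    | zero => simp
    | succ n ih => exact ih.trans ((hstep _).trans_eq (by rw [pow_succ', mul_assoc]))
  have hzero : ∀ r, 0 < r → μ (E r) = 0 := by
    intro r hr
    have hanti : Antitone fun n : ℕ => E (R ^ n * r) := by
      intro m n hmn x hx
      have : R ^ m * r ≤ R ^ n * r := by gcongr; exact hR.le
      exact lt_of_le_of_lt this hx
    have hlim := tendsto_measure_iInter_atTop (μ := μ)
      (fun n : ℕ => (hmeas (R ^ n * r)).nullMeasurableSet) hanti ⟨0, measure_ne_top _ _⟩
    have hempty : ⋂ n : ℕ, E (R ^ n * r) = ∅ := by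
      rw [Set.eq_empty_iff_forall_notMem]
      intro x hx
      rw [Set.mem_iInter] at hx
      obtain ⟨n, hn⟩ := pow_unbounded_of_one_lt (Metric.infDist x (attractor R B) / r) hR
      rw [div_lt_iff₀ hr] at hn
      exact lt_asymm hn (hx n)
    rw [hempty, measure_empty] at hlim
    exact le_antisymm (ge_of_tendsto' hlim (hiter r)) zero_le
  have hcover : (attractor R B)ᶜ ⊆ ⋃ n : ℕ, E (1 / ((n : ℝ) + 1)) := by
    intro x hx
    have hpos := (hcomp.isClosed.notMem_iff_infDist_pos hne).1 hx
    obtain ⟨n, hn⟩ := exists_nat_one_div_lt hpos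
    exact Set.mem_iUnion.2 ⟨n, hn⟩
  exact measure_mono_null hcover (measure_iUnion_null fun n => hzero _ (by positivity))

/-! ### The operators `S_w` on exponentials -/

/-- Holds for whichever b the choice selects; staying in the attractor allows iteration along a
word. -/
theorem exists_shiftMap_eq {R : ℝ} (hR : 1 < R) {B : Finset ℝ} (hB : B.Nonempty) {x : ℝ}
    (hx : x ∈ attractor R B) :
    shiftMap R B x ∈ attractor R B ∧ ∃ b ∈ B, shiftMap R B x = R * x - b := by
  have h : ∃ b ∈ B, x ∈ ifsMap R b '' attractor R B := by
    rw [(attractor_spec hR hB).2.2] at hx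
    simpa using hx
  obtain ⟨hb, y, hy, hyx⟩ := h.choose_spec
  have hs : shiftMap R B x = R * x - h.choose := by simp only [shiftMap, dif_pos h]
  refine ⟨?_, _, hb, hs⟩
  have hR0 : R ≠ 0 := by positivity
  have : shiftMap R B x = y := by
    rw [hs]
    nth_rw 1 [← hyx]
    unfold ifsMap
    field_simp
    ring
  rwa [this]

/-- The frequency of `S_w e_t`. -/
def wordFreq (R : ℝ) (w : List ℝ) (t : ℝ) : ℝ := w.foldr (fun l s => l + R * s) t

theorem wordFreq_mem_dualPeriods {R : ℝ} {B L : Finset ℝ} (hRint : R ∈ Set.range ((↑) : ℤ → ℝ))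
    (hBint : (B : Set ℝ) ⊆ Set.range ((↑) : ℤ → ℝ))
    (hLint : (L : Set ℝ) ⊆ Set.range ((↑) : ℤ → ℝ)) {w : List ℝ} (hw : ∀ l ∈ w, l ∈ L) {t : ℝ}
    (ht : t ∈ dualPeriods B) : wordFreq R w t ∈ dualPeriods B := by
  induction w with
  | nil => exact ht
  | cons l w ih =>
    exact (dualPeriods B).add_mem (int_mem_dualPeriods hBint (hLint (hw l (by simp))))
      (int_mul_mem_dualPeriods hRint (ih fun l hl => hw l (by simp [hl])))

/-- On the attractor `S_w e_t` is an exponential, whichever piece `r` selects at a point of overlap: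
the digits of `B` are periods of `e_t`. -/
theorem cuntzWord_expFun {R : ℝ} (hR : 1 < R) {B L : Finset ℝ} (hB : B.Nonempty)
    (hRint : R ∈ Set.range ((↑) : ℤ → ℝ)) (hBint : (B : Set ℝ) ⊆ Set.range ((↑) : ℤ → ℝ))
    (hLint : (L : Set ℝ) ⊆ Set.range ((↑) : ℤ → ℝ)) {w : List ℝ} (hw : ∀ l ∈ w, l ∈ L) {t : ℝ}
    (ht : t ∈ dualPeriods B) :
    ∀ x ∈ attractor R B, cuntzWord R B w (expFun t) x = expFun (wordFreq R w t) x := by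
  induction w with
  | nil => exact fun _ _ => rfl
  | cons l w ih =>
    intro x hx
    have hw' : ∀ l ∈ w, l ∈ L := fun l hl => hw l (by simp [hl])
    obtain ⟨hx', b, hb, hs⟩ := exists_shiftMap_eq hR hB hx
    change expFun l x * cuntzWord R B w (expFun t) (shiftMap R B x) =
      expFun (l + R * wordFreq R w t) x
    rw [ih hw' _ hx', hs, expFun_add, sub_eq_add_neg, expFun_add_right, expFun_comm _ (-b),
      expFun_neg, expFun_of_mem_dualPeriods (wordFreq_mem_dualPeriods hRint hBint hLint hw' ht) hb,
      inv_one, mul_one]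
    congr 1
    unfold expFun
    congr 1
    push_cast
    ring

/-! ### The Fourier transform of the invariant measure -/

theorem integral_expFun_eq_charFun (μ : Measure ℝ) (t : ℝ) :
    ∫ x, expFun t x ∂μ = charFun μ (2 * Real.pi * t) := by
  rw [charFun_apply_real]
  congr 1
  ext x
  unfold expFun
  congr 1
  push_cast
  ring

/-- Self-similarity in Fourier form, the source of both the orthogonality and the harmonicity of h.
-/
theorem integral_expFun_mul {R : ℝ} (hR : 1 < R) {B : Finset ℝ} {μ : Measure ℝ}
    (hμ : IsInvariantMeasure R B μ) (t : ℝ) :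
    ∫ x, expFun (R * t) x ∂μ = maskFun B t * ∫ x, expFun t x ∂μ := by
  have hR0 : (R : ℂ) ≠ 0 := by exact_mod_cast (by positivity : R ≠ 0)
  have hR1 : R ≠ 0 := by positivity
  rw [integral_expFun_eq_charFun, hμ.charFun_eq, integral_expFun_eq_charFun,
    show R⁻¹ * (2 * Real.pi * (R * t)) = 2 * Real.pi * t by field_simp]
  congr 1
  unfold maskFun
  congr 1
  refine Finset.sum_congr rfl fun b _ => ?_
  unfold expFun
  congr 1
  push_cast
  field_simp

/-- The finite measures g⁺μ and g⁻μ have the same Fourier transform, hence coincide. Then g⁺ = g⁻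
almost everywhere, and at each point one of the two is 0. -/
theorem ae_eq_zero_of_integral_expFun_mul_real {μ : Measure ℝ} {g : ℝ → ℝ} (hg : Integrable g μ)
    (h : ∀ t, ∫ x, expFun t x * (g x : ℂ) ∂μ = 0) : g =ᵐ[μ] 0 := by
  have hgn := hg.neg
  have hi : ∀ {f : ℝ → ℝ}, Integrable f μ → ∀ t,
      Integrable (fun x => expFun t x * ((max (f x) 0 : ℝ) : ℂ)) μ := by
    intro f hf t
    refine (hf.pos_part.ofReal (𝕜 := ℂ)).bdd_mul (c := 1)
      (continuous_expFun t).aestronglyMeasurable ?_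
    exact Filter.Eventually.of_forall fun x => (norm_expFun t x).le
  have hchar : ∀ {f : ℝ → ℝ}, Integrable f μ → ∀ t,
      charFun (μ.withDensity fun x => ENNReal.ofReal (f x)) t =
        ∫ x, expFun (t / (2 * Real.pi)) x * ((max (f x) 0 : ℝ) : ℂ) ∂μ := by
    intro f hf t
    have hpi : (2 * Real.pi : ℝ) ≠ 0 := by positivity
    have := integral_expFun_eq_charFun (μ.withDensity fun x => ENNReal.ofReal (f x))
      (t / (2 * Real.pi))
    rw [mul_div_cancel₀ _ hpi] at this
    rw [← this, integral_withDensity_eq_integral_toReal_smul₀ hf.1.aemeasurable.ennreal_ofReal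
      (Filter.Eventually.of_forall fun x => ENNReal.ofReal_lt_top)]
    congr 1
    ext x
    rw [ENNReal.toReal_ofReal', Complex.real_smul, mul_comm]
  have hfin := isFiniteMeasure_withDensity_ofReal hg.2
  have hfin' := isFiniteMeasure_withDensity_ofReal hgn.2
  have heq : (μ.withDensity fun x => ENNReal.ofReal (g x)) =
      μ.withDensity fun x => ENNReal.ofReal ((-g) x) := by
    refine Measure.ext_of_charFun (funext fun t => ?_)
    rw [hchar hg, hchar hgn, ← sub_eq_zero, ← integral_sub (hi hg _) (hi hgn _),
      ← h (t / (2 * Real.pi))]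
    congr 1
    ext x
    rw [← mul_sub, ← Complex.ofReal_sub]
    congr 2
    rcases le_total 0 (g x) with h0 | h0
    · simp [h0]
    · simp [h0]
  have hne : ∫⁻ x, ENNReal.ofReal (g x) ∂μ ≠ ∞ := by
    have := measure_ne_top (μ.withDensity fun x => ENNReal.ofReal (g x)) Set.univ
    rwa [withDensity_apply _ MeasurableSet.univ, Measure.restrict_univ] at this
  rw [withDensity_eq_iff hg.1.aemeasurable.ennreal_ofReal hgn.1.aemeasurable.ennreal_ofReal
    hne] at heq
  filter_upwards [heq] with x hx
  simp only [Pi.neg_apply] at hx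
  rcases lt_trichotomy (g x) 0 with h0 | h0 | h0
  · rw [ENNReal.ofReal_of_nonpos h0.le] at hx
    have := ENNReal.ofReal_eq_zero.1 hx.symm
    linarith
  · exact h0
  · rw [ENNReal.ofReal_of_nonpos (neg_nonpos.2 h0.le)] at hx
    have := ENNReal.ofReal_eq_zero.1 hx
    linarith

/-- Conjugation sends e_t to e_{-t}, so the conjugate of f satisfies the same hypothesis and the
real case applies to Re f and Im f. -/
theorem ae_eq_zero_of_integral_expFun_mul {μ : Measure ℝ} {f : ℝ → ℂ} (hf : Integrable f μ)
    (h : ∀ t, ∫ x, expFun t x * f x ∂μ = 0) : f =ᵐ[μ] 0 := by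
  have hconj : ∀ t, ∫ x, expFun t x * (starRingEnd ℂ) (f x) ∂μ = 0 := by
    intro t
    have := congrArg (starRingEnd ℂ) (h (-t))
    rw [← integral_conj, map_zero] at this
    rw [← this]
    congr 1
    ext x
    rw [map_mul, conj_expFun, neg_neg]
  have hi : ∀ {f : ℝ → ℂ}, Integrable f μ → ∀ t, Integrable (fun x => expFun t x * f x) μ :=
    fun hf t => hf.bdd_mul (c := 1) (continuous_expFun t).aestronglyMeasurable
      (Filter.Eventually.of_forall fun x => (norm_expFun t x).le)
  have hfc : Integrable (fun x => (starRingEnd ℂ) (f x)) μ :=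
    Complex.conjLIE.toContinuousLinearEquiv.toContinuousLinearMap.integrable_comp hf
  have hre := ae_eq_zero_of_integral_expFun_mul_real (g := fun x => (f x).re) hf.re fun t => by
    calc ∫ x, expFun t x * ((f x).re : ℂ) ∂μ
        = ∫ x, (1 / 2 : ℂ) * (expFun t x * f x + expFun t x * (starRingEnd ℂ) (f x)) ∂μ := by
          congr 1; ext x; rw [Complex.re_eq_add_conj]; ring
      _ = 0 := by
          rw [integral_const_mul, integral_add (hi hf t) (hi hfc t), h, hconj]; simp
  have him := ae_eq_zero_of_integral_expFun_mul_real (g := fun x => (f x).im) hf.im fun t => by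
    calc ∫ x, expFun t x * ((f x).im : ℂ) ∂μ
        = ∫ x, (1 / (2 * Complex.I)) * (expFun t x * f x - expFun t x * (starRingEnd ℂ) (f x)) ∂μ := by
          congr 1; ext x; rw [Complex.im_eq_sub_conj]; ring
      _ = 0 := by
          rw [integral_const_mul, integral_sub (hi hf t) (hi hfc t), h, hconj]; simp
  filter_upwards [hre, him] with x h1 h2
  exact Complex.ext h1 h2

/-! ### The frequencies -/

/-- The frequencies of the functions `S_w e_{-c}`. -/
def cycleFreq (R : ℝ) (B L : Finset ℝ) : Set ℝ :=
  {t | ∃ (w : List ℝ) (c : ℝ), (∀ l ∈ w, l ∈ L) ∧ IsExtremeCyclePoint R B L c ∧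
    t = wordFreq R w (-c)}

variable {R : ℝ} {B L : Finset ℝ}

theorem IsExtremeCyclePoint.mem_dualPeriods (hB0 : (0 : ℝ) ∈ B) {c : ℝ}
    (hc : IsExtremeCyclePoint R B L c) : c ∈ dualPeriods B := by
  obtain ⟨p, l, x, hp, h0, -, h⟩ := hc
  rw [← h0]
  exact mem_dualPeriods_of_norm_maskFun hB0 (h 0 hp).2.2

theorem IsExtremeCyclePoint.exists_next {c : ℝ} (hc : IsExtremeCyclePoint R B L c) :
    ∃ l ∈ L, IsExtremeCyclePoint R B L ((c + l) / R) := by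
  obtain ⟨p, l, x, hp, h0, hxp, h⟩ := hc
  -- The cycle rotated by one place. Letters and points wrap around at the end, since the original
  -- data mean nothing beyond index p.
  refine ⟨l 0, (h 0 hp).1, p, fun i => if i + 1 < p then l (i + 1) else l 0,
    fun i => if i < p then x (i + 1) else x 1, hp, ?_, ?_, fun i hi => ?_⟩
  · simp only [if_pos hp]
    rw [(h 0 hp).2.1, h0]
  · simp only [lt_irrefl, if_false]
    rw [← h0]
    exact (h 0 hp).2.1
  · simp only [if_pos hi]
    by_cases hi' : i + 1 < p
    · simp only [if_pos hi']
      exact h _ hi'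
    · simp only [if_neg hi']
      rw [show i + 1 = p by omega, hxp, ← h0]
      exact h 0 hp

theorem isExtremeCyclePoint_zero (hB : B.Nonempty) (hL0 : (0 : ℝ) ∈ L) :
    IsExtremeCyclePoint R B L 0 :=
  ⟨1, fun _ => 0, fun _ => 0, one_pos, rfl, rfl, fun _ _ =>
    ⟨hL0, by simp, by rw [maskFun_zero hB, norm_one]⟩⟩

theorem neg_mem_cycleFreq {c : ℝ} (hc : IsExtremeCyclePoint R B L c) : -c ∈ cycleFreq R B L :=
  ⟨[], c, by simp, hc, rfl⟩

theorem cycleFreq_subset_dualPeriods (hB0 : (0 : ℝ) ∈ B) (hRint : R ∈ Set.range ((↑) : ℤ → ℝ))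
    (hBint : (B : Set ℝ) ⊆ Set.range ((↑) : ℤ → ℝ))
    (hLint : (L : Set ℝ) ⊆ Set.range ((↑) : ℤ → ℝ)) {t : ℝ} (ht : t ∈ cycleFreq R B L) :
    t ∈ dualPeriods B := by
  obtain ⟨w, c, hw, hc, rfl⟩ := ht
  exact wordFreq_mem_dualPeriods hRint hBint hLint hw
    ((dualPeriods B).neg_mem (hc.mem_dualPeriods hB0))

theorem add_mul_mem_cycleFreq {l s : ℝ} (hl : l ∈ L) (hs : s ∈ cycleFreq R B L) :
    l + R * s ∈ cycleFreq R B L := by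
  obtain ⟨w, c, hw, hc, rfl⟩ := hs
  refine ⟨l :: w, c, ?_, hc, rfl⟩
  simpa [hl] using hw

/-- For the empty word the letter comes from the cycle itself: if c' = (c + l)/R is the next cycle
point, then -c = l + R(-c'). -/
theorem exists_eq_add_mul (hR : 1 < R) {t : ℝ} (ht : t ∈ cycleFreq R B L) :
    ∃ l ∈ L, ∃ s ∈ cycleFreq R B L, t = l + R * s := by
  obtain ⟨w, c, hw, hc, rfl⟩ := ht
  rcases w with _ | ⟨l, w⟩
  · obtain ⟨l, hl, hc'⟩ := hc.exists_next
    refine ⟨l, hl, _, neg_mem_cycleFreq hc', ?_⟩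
    have hR0 : R ≠ 0 := by positivity
    simp only [wordFreq, List.foldr_nil]
    field_simp
    ring
  · exact ⟨l, hw l (by simp), _, ⟨w, c, fun l hl => hw l (by simp [hl]), hc, rfl⟩, rfl⟩

/-- Needed for the degenerate case N = 1. With all letters zero a cycle satisfies R^p c = c, so c =
0. -/
theorem eq_zero_of_mem_cycleFreq (hR : 1 < R) (hL : ∀ l ∈ L, l = 0) {t : ℝ}
    (ht : t ∈ cycleFreq R B L) : t = 0 := by
  obtain ⟨w, c, hw, ⟨p, l, x, hp, h0, hxp, h⟩, rfl⟩ := ht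
  have hR0 : R ≠ 0 := by positivity
  have hx : ∀ i ≤ p, R ^ i * x i = c := by
    intro i
    induction i with
    | zero => intro _; simp [h0]
    | succ i ih =>
      intro hi
      rw [(h i (by omega)).2.1, hL _ (h i (by omega)).1, add_zero, pow_succ, mul_assoc,
        mul_div_cancel₀ _ hR0, ih (by omega)]
  have hc : c = 0 := by
    have h1 := hx p le_rfl
    have h2 := one_lt_pow₀ hR hp.ne'
    rw [hxp] at h1
    have h3 : (R ^ p - 1) * c = 0 := by linarith
    rcases mul_eq_zero.1 h3 with h4 | h4
    · linarith
    · exact h4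
  rw [hc, neg_zero]
  induction w with
  | nil => simp [wordFreq]
  | cons l w ih =>
    have h1 : wordFreq R w 0 = 0 := ih (fun l hl => hw l (by simp [hl]))
    change l + R * wordFreq R w 0 = 0
    rw [h1, hL l (hw l (by simp))]
    simp

/-! ### Orthogonality -/

section orthogonality

variable {μ : Measure ℝ}

/-- After factoring out R, the difference s' - s is a period of m_B, and only (l' - l)/R matters. -/
theorem integral_expFun_eq_zero_of_ne (hR : 1 < R) (hμ : IsInvariantMeasure R B μ)
    (hspec : IsSpectrum (B.image fun b => R⁻¹ * b) L) {l l' s s' : ℝ} (hl : l ∈ L) (hl' : l' ∈ L)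
    (hne : l ≠ l') (hs : s ∈ dualPeriods B) (hs' : s' ∈ dualPeriods B) :
    ∫ x, expFun ((l' + R * s') - (l + R * s)) x ∂μ = 0 := by
  have hR0 : R ≠ 0 := by positivity
  rw [show (l' + R * s') - (l + R * s) = R * ((l' - l) / R + (s' - s)) by field_simp; ring,
    integral_expFun_mul hR hμ, maskFun_add_of_mem ((dualPeriods B).sub_mem hs' hs),
    maskFun_eq_zero_of_isSpectrum hR hspec hl hl' hne, zero_mul]

theorem two_le_of_one_lt (hR : 1 < R) (hRint : R ∈ Set.range ((↑) : ℤ → ℝ)) :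
    ∃ r : ℕ, 2 ≤ r ∧ R = r := by
  obtain ⟨r, rfl⟩ := hRint
  have h : 1 < r := by exact_mod_cast hR
  lift r to ℕ using by omega
  exact ⟨r, by omega, by simp⟩

theorem integral_expFun_sub_of_mem_cycleFreq (hR : 1 < R) (hB0 : (0 : ℝ) ∈ B) (hL0 : (0 : ℝ) ∈ L)
    (hμ : IsInvariantMeasure R B μ) (hspec : IsSpectrum (B.image fun b => R⁻¹ * b) L)
    (hRint : R ∈ Set.range ((↑) : ℤ → ℝ)) (hBint : (B : Set ℝ) ⊆ Set.range ((↑) : ℤ → ℝ))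
    (hLint : (L : Set ℝ) ⊆ Set.range ((↑) : ℤ → ℝ)) {t t' : ℝ} (ht : t ∈ cycleFreq R B L)
    (ht' : t' ∈ cycleFreq R B L) (hne : t ≠ t') : ∫ x, expFun (t' - t) x ∂μ = 0 := by
  have hper := fun {t} (ht : t ∈ cycleFreq R B L) =>
    cycleFreq_subset_dualPeriods hB0 hRint hBint hLint ht
  obtain ⟨r, hr, hRr⟩ := two_le_of_one_lt hR hRint
  by_cases hb : ∃ b ∈ B, b ≠ 0
  · obtain ⟨b, hb, hb0⟩ := hb
    -- Induction on the size of the integer b(t' - t): cancelling an equal leading letter divides it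
    -- by R ≥ 2, and it is nonzero for distinct frequencies.
    have key : ∀ n : ℕ, ∀ t ∈ cycleFreq R B L, ∀ t' ∈ cycleFreq R B L, t ≠ t' →
        |b * (t' - t)| ≤ n → ∫ x, expFun (t' - t) x ∂μ = 0 := by
      intro n
      induction n with
      | zero =>
        intro t _ t' _ hne hle
        have h1 : b * (t' - t) = 0 := by
          rwa [Nat.cast_zero, abs_nonpos_iff] at hle
        rcases mul_eq_zero.1 h1 with h2 | h2
        · exact absurd h2 hb0
        · exact absurd (sub_eq_zero.1 h2).symm hne
      | succ n ih =>
        intro t ht t' ht' hne hle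
        obtain ⟨l, hl, s, hs, rfl⟩ := exists_eq_add_mul hR ht
        obtain ⟨l', hl', s', hs', rfl⟩ := exists_eq_add_mul hR ht'
        by_cases hll : l = l'
        · subst hll
          have hss : s ≠ s' := fun h => hne (by rw [h])
          have hd := (dualPeriods B).sub_mem (hper hs') (hper hs)
          have h0 : ∫ x, expFun (s' - s) x ∂μ = 0 := by
            refine ih s hs s' hs' hss ?_
            obtain ⟨k, hk⟩ := hd b hb
            rw [show b * (l + R * s' - (l + R * s)) = r * (b * (s' - s)) by rw [← hRr]; ring, hk,
              abs_mul, Nat.abs_cast] at hle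
            rw [hk]
            have h1 : (r : ℤ) * |k| ≤ n + 1 := by exact_mod_cast hle
            have h2 : |k| ≠ 0 := by
              rw [abs_ne_zero]
              rintro rfl
              rcases mul_eq_zero.1 (hk.trans Int.cast_zero) with h3 | h3
              · exact hb0 h3
              · exact hss (sub_eq_zero.1 h3).symm
            have h3 : |k| ≤ n := by
              have h4 : (2 : ℤ) ≤ r := by exact_mod_cast hr
              have h5 := abs_nonneg k
              have h6 : 2 * |k| ≤ r * |k| := by gcongr
              omega
            exact_mod_cast h3
          rw [show l + R * s' - (l + R * s) = R * (s' - s) by ring, integral_expFun_mul hR hμ, h0,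
            mul_zero]
        · exact integral_expFun_eq_zero_of_ne hR hμ hspec hl hl' hll (hper hs) (hper hs')
    obtain ⟨n, hn⟩ := exists_nat_ge |b * (t' - t)|
    exact key n t ht t' ht' hne hn
  · push Not at hb
    have hcard : L.card = 1 := by
      rw [hspec.1, card_image_inv_mul hR, Finset.card_eq_one]
      exact ⟨0, Finset.eq_singleton_iff_unique_mem.2 ⟨hB0, hb⟩⟩
    have hL : ∀ l ∈ L, l = 0 := fun l hl => Finset.card_le_one.1 hcard.le l hl 0 hL0
    exact absurd ((eq_zero_of_mem_cycleFreq hR hL ht).trans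
      (eq_zero_of_mem_cycleFreq hR hL ht').symm) hne

/-- The frequencies are in bijection with pairs of a letter and a frequency. -/
theorem bijective_add_mul (hR : 1 < R) (hB0 : (0 : ℝ) ∈ B)
    (hμ : IsInvariantMeasure R B μ) (hspec : IsSpectrum (B.image fun b => R⁻¹ * b) L)
    (hRint : R ∈ Set.range ((↑) : ℤ → ℝ)) (hBint : (B : Set ℝ) ⊆ Set.range ((↑) : ℤ → ℝ))
    (hLint : (L : Set ℝ) ⊆ Set.range ((↑) : ℤ → ℝ)) :
    Function.Bijective fun p : L × cycleFreq R B L =>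
      (⟨p.1 + R * p.2, add_mul_mem_cycleFreq p.1.2 p.2.2⟩ : cycleFreq R B L) := by
  have := hμ.isProbabilityMeasure
  have hper := fun {t} (ht : t ∈ cycleFreq R B L) =>
    cycleFreq_subset_dualPeriods hB0 hRint hBint hLint ht
  have hR0 : R ≠ 0 := by positivity
  constructor
  · rintro ⟨l, s⟩ ⟨l', s'⟩ h
    rw [Subtype.mk.injEq] at h
    simp only at h
    -- If the letters differed, orthogonality would give ∫ e_0 dμ = 0, whereas μ has mass 1.
    have hl : l = l' := by
      by_contra hne
      have h1 := integral_expFun_eq_zero_of_ne hR hμ hspec l.2 l'.2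
        (fun h => hne (Subtype.ext h)) (hper s.2) (hper s'.2)
      rw [h, sub_self] at h1
      simp [expFun_zero] at h1
    subst hl
    have hs : (s : ℝ) = s' := mul_left_cancel₀ hR0 (add_left_cancel h)
    rw [Subtype.ext hs]
  · rintro ⟨t, ht⟩
    obtain ⟨l, hl, s, hs, rfl⟩ := exists_eq_add_mul hR ht
    exact ⟨(⟨l, hl⟩, ⟨s, hs⟩), rfl⟩

end orthogonality

/-! ### Exponentials in `L²` -/

section L2

variable (μ : Measure ℝ) [IsProbabilityMeasure μ]

theorem memLp_expFun (t : ℝ) : MemLp (expFun t) 2 μ :=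
  MemLp.of_bound (continuous_expFun t).aestronglyMeasurable 1
    (Filter.Eventually.of_forall fun x => (norm_expFun t x).le)

/-- The class of `e_t` in `L²(μ)`. -/
def expLp (t : ℝ) : Lp ℂ 2 μ := (memLp_expFun μ t).toLp

theorem coeFn_expLp (t : ℝ) : expLp μ t =ᵐ[μ] expFun t := (memLp_expFun μ t).coeFn_toLp

theorem inner_expLp_left (t : ℝ) (f : Lp ℂ 2 μ) :
    inner ℂ (expLp μ t) f = ∫ x, expFun (-t) x * f x ∂μ := by
  rw [L2.inner_def]
  refine integral_congr_ae ?_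
  filter_upwards [coeFn_expLp μ t] with x hx
  rw [hx, RCLike.inner_apply, conj_expFun, mul_comm]

theorem inner_expLp (s t : ℝ) : inner ℂ (expLp μ s) (expLp μ t) = ∫ x, expFun (t - s) x ∂μ := by
  rw [inner_expLp_left]
  refine integral_congr_ae ?_
  filter_upwards [coeFn_expLp μ t] with x hx
  rw [hx, ← expFun_add]
  congr 1
  ring

theorem norm_expLp (t : ℝ) : ‖expLp μ t‖ = 1 := by
  have h := inner_self_eq_norm_sq_to_K (𝕜 := ℂ) (expLp μ t)
  rw [inner_expLp, sub_self] at h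
  simp only [expFun_zero, integral_const, probReal_univ, one_smul] at h
  have h2 : ‖expLp μ t‖ ^ 2 = 1 := Complex.ofReal_injective (by simpa using h.symm)
  rwa [pow_eq_one_iff_of_nonneg (norm_nonneg _) two_ne_zero] at h2

theorem eq_zero_of_inner_expLp {f : Lp ℂ 2 μ} (h : ∀ t, inner ℂ (expLp μ t) f = 0) : f = 0 := by
  rw [Lp.eq_zero_iff_ae_eq_zero]
  refine ae_eq_zero_of_integral_expFun_mul ((Lp.memLp f).integrable one_le_two) fun t => ?_
  rw [← h (-t), inner_expLp_left, neg_neg]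

variable {μ}

/-- If `μ` has bounded support then `t ↦ e_t` is a real-analytic map to `L²(μ)`. -/
theorem analyticAt_expLp {C : ℝ} (hC : ∀ᵐ x ∂μ, |x| ≤ C) (t : ℝ) :
    AnalyticAt ℝ (expLp μ) t := by
  -- The function 2πix, with x truncated to [-C, C] to be bounded on ℝ. In the Banach algebra of
  -- bounded continuous functions exp(tf) is analytic in t, and it agrees with e_t almost
  -- everywhere.
  let f : BoundedContinuousFunction ℝ ℂ := BoundedContinuousFunction.ofNormedAddCommGroup
    (fun x => 2 * Real.pi * Complex.I * ((max (-C) (min C x) : ℝ) : ℂ)) (by fun_prop)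
    (2 * Real.pi * |C|) (fun x => by
      have h1 : |max (-C) (min C x)| ≤ |C| := by
        rw [abs_le]
        constructor
        · exact (neg_le_neg (le_abs_self C)).trans (le_max_left _ _)
        · exact max_le (neg_le_abs C) ((min_le_left _ _).trans (le_abs_self C))
      rw [norm_mul, Complex.norm_real, Real.norm_eq_abs]
      have h2 : ‖(2 * Real.pi * Complex.I : ℂ)‖ = 2 * Real.pi := by
        simp [abs_of_pos Real.pi_pos]
      rw [h2]
      gcongr)
  have heq : expLp μ = fun t : ℝ => BoundedContinuousFunction.toLp 2 μ ℝ
      (NormedSpace.exp (t • f)) := by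
    funext s
    refine Lp.ext ?_
    have h1 := BoundedContinuousFunction.coeFn_toLp (p := 2) μ ℝ (NormedSpace.exp (s • f))
    filter_upwards [coeFn_expLp μ s, h1, hC] with x hx hx1 hxC
    rw [hx, hx1]
    obtain ⟨h2, h3⟩ := abs_le.1 hxC
    let ev : BoundedContinuousFunction ℝ ℂ →+* ℂ :=
      { toFun := fun g => g x
        map_one' := rfl
        map_mul' := fun _ _ => rfl
        map_zero' := rfl
        map_add' := fun _ _ => rfl }
    have hev : Continuous ev := (BoundedContinuousFunction.lipschitz_eval_const x).continuous
    have h4 := NormedSpace.map_exp ev hev (s • f)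
    change (NormedSpace.exp (s • f)) x = NormedSpace.exp ((s • f) x) at h4
    rw [h4, ← Complex.exp_eq_exp_ℂ]
    simp only [BoundedContinuousFunction.coe_smul, Complex.real_smul, expFun, f,
      BoundedContinuousFunction.coe_ofNormedAddCommGroup, min_eq_right h3, max_eq_right h2]
    congr 1
    ring
  rw [heq]
  have h1 : AnalyticAt ℝ (fun t : ℝ => t • f) t :=
    ((ContinuousLinearMap.id ℝ ℝ).smulRight f).analyticAt t
  have h2 : AnalyticAt ℝ NormedSpace.exp (t • f) := NormedSpace.exp_analytic _
  exact ((BoundedContinuousFunction.toLp 2 μ ℝ).analyticAt _).comp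
    (h2.comp (f := fun t : ℝ => t • f) h1)

/-- The squared norm is the real part of the inner product, a bounded bilinear map over ℝ. -/
theorem analyticAt_norm_sq_expLp {C : ℝ} (hC : ∀ᵐ x ∂μ, |x| ≤ C) (P : Lp ℂ 2 μ →L[ℂ] Lp ℂ 2 μ)
    (t : ℝ) : AnalyticAt ℝ (fun t => ‖P (expLp μ (-t))‖ ^ 2) t := by
  have h1 : AnalyticAt ℝ (fun t => P (expLp μ (-t))) t :=
    ((P.restrictScalars ℝ).analyticAt _).comp
      ((analyticAt_expLp hC (-t)).comp (f := fun t : ℝ => -t) analyticAt_id.neg)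
  let I := (isBoundedBilinearMap_inner (𝕜 := ℂ) (E := Lp ℂ 2 μ)).toContinuousLinearMap
  have h2 : AnalyticAt ℝ (fun t => I (P (expLp μ (-t))) (P (expLp μ (-t)))) t :=
    (I.analyticAt_bilinear _).comp (h1.prod h1)
  have h3 := (Complex.reCLM.analyticAt _).comp h2
  refine h3.congr (Filter.Eventually.of_forall fun t => ?_)
  exact inner_self_eq_norm_sq (𝕜 := ℂ) (P (expLp μ (-t)))

end L2

/-- The norm of the projection to the closed span of an orthonormal family. -/
theorem hasSum_norm_sq_starProjection {ι E : Type*} [NormedAddCommGroup E] [InnerProductSpace ℂ E]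
    [CompleteSpace E] {v : ι → E} (hv : Orthonormal ℂ v) (x : E) :
    HasSum (fun i => ‖inner ℂ (v i) x‖ ^ 2)
      (‖(Submodule.span ℂ (Set.range v)).topologicalClosure.starProjection x‖ ^ 2) := by
  set H := (Submodule.span ℂ (Set.range v)).topologicalClosure with hH
  have hvH : ∀ i, v i ∈ H := fun i =>
    Submodule.le_topologicalClosure _ (Submodule.subset_span ⟨i, rfl⟩)
  have hv' : Orthonormal ℂ fun i => (⟨v i, hvH i⟩ : H) := by
    classical
    rw [orthonormal_iff_ite] at hv ⊢
    exact hv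
  have hbot : (Submodule.span ℂ (Set.range fun i => (⟨v i, hvH i⟩ : H)))ᗮ = ⊥ := by
    rw [Submodule.eq_bot_iff]
    intro y hy
    have h1 : (y : E) ∈ (Submodule.span ℂ (Set.range v))ᗮ := by
      rw [Submodule.mem_orthogonal]
      intro u hu
      induction hu using Submodule.span_induction with
      | mem u hu =>
        obtain ⟨i, rfl⟩ := hu
        exact (Submodule.mem_orthogonal _ _).1 hy ⟨v i, hvH i⟩ (Submodule.subset_span ⟨i, rfl⟩)
      | zero => simp
      | add a b _ _ ha hb => rw [inner_add_left, ha, hb, add_zero]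
      | smul a b _ hb => rw [inner_smul_left, hb, mul_zero]
    rw [← Submodule.orthogonal_closure] at h1
    have h2 := (Submodule.mem_orthogonal _ _).1 h1 y y.2
    exact Subtype.ext (inner_self_eq_zero.1 h2)
  -- The family is a Hilbert basis of its own closed span, so the claim is Parseval's identity
  -- there.
  let b := HilbertBasis.mkOfOrthogonalEqBot hv' hbot
  have hb : ∀ i, b i = ⟨v i, hvH i⟩ := fun i =>
    congrFun (HilbertBasis.coe_mkOfOrthogonalEqBot hv' hbot) i
  have h := b.hasSum_inner_mul_inner (H.orthogonalProjectionOnto x) (H.orthogonalProjectionOnto x)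
  rw [inner_self_eq_norm_sq_to_K] at h
  have h2 := Complex.hasSum_re h
  convert h2 using 1
  · funext i
    rw [← inner_conj_symm _ (b i), ← Complex.normSq_eq_conj_mul_self, Complex.ofReal_re,
      Complex.normSq_eq_norm_sq, hb, Submodule.inner_orthogonalProjectionOnto_eq_of_mem_left]
  · norm_cast

/-! ### Maxima of subharmonic analytic functions -/

/-- A function that is real-analytic and invariant for the transfer operator, and that vanishes on
the extreme cycles, is nowhere positive. -/
theorem nonpos_of_harmonic {R : ℝ} {B L : Finset ℝ} (hR : 1 < R) (hB : B.Nonempty)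
    (hL0 : (0 : ℝ) ∈ L) (hRint : R ∈ Set.range ((↑) : ℤ → ℝ))
    (hLint : (L : Set ℝ) ⊆ Set.range ((↑) : ℤ → ℝ))
    (hinc : ∀ l ∈ L, ∀ l' ∈ L, ∀ k : ℤ, l' - l = k * R → l = l')
    (hsum : ∀ x, ∑ l ∈ L, ‖maskFun B ((x + l) / R)‖ ^ 2 = 1) {g : ℝ → ℝ}
    (hg : AnalyticOnNhd ℝ g Set.univ)
    (hharm : ∀ x, g x = ∑ l ∈ L, ‖maskFun B ((x + l) / R)‖ ^ 2 * g ((x + l) / R))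
    (hcyc : ∀ c, IsExtremeCyclePoint R B L c → g c = 0) (t : ℝ) : g t ≤ 0 := by
  obtain ⟨r, hr, hRr⟩ := two_le_of_one_lt hR hRint
  have hR2 : 2 ≤ R := by rw [hRr]; exact_mod_cast hr
  set A : ℝ := |t| + ∑ l ∈ L, |l| with hA
  have hlA : ∀ l ∈ L, |l| ≤ A := fun l hl =>
    (Finset.single_le_sum (f := fun l : ℝ => |l|) (fun _ _ => abs_nonneg _) hl).trans
      (le_add_of_nonneg_left (abs_nonneg t))
  have htA : t ∈ Set.Icc (-A) A := abs_le.1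
    (le_add_of_nonneg_right (Finset.sum_nonneg fun _ _ => abs_nonneg _))
  have hA0 : 0 ≤ A := (abs_nonneg t).trans (abs_le.2 htA)
  -- Since R ≥ 2, |x + l|/R ≤ 2A/R ≤ A.
  have hinv : ∀ x ∈ Set.Icc (-A) A, ∀ l ∈ L, (x + l) / R ∈ Set.Icc (-A) A := by
    intro x hx l hl
    have h1 := abs_le.1 (hlA l hl)
    rw [Set.mem_Icc, le_div_iff₀ (by positivity), div_le_iff₀ (by positivity)]
    constructor <;> nlinarith [hx.1, hx.2, h1.1, h1.2]
  obtain ⟨x₀, hx₀, hmax⟩ := isCompact_Icc.exists_isMaxOn ⟨t, htA⟩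
    (fun x _ => (hg x trivial).continuousAt.continuousWithinAt : ContinuousOn g (Set.Icc (-A) A))
  have hmax' : ∀ x ∈ Set.Icc (-A) A, g x ≤ g x₀ := fun x hx => hmax hx
  refine (hmax' t htA).trans ?_
  by_contra! hpos
  set Z : Set ℝ := {x ∈ Set.Icc (-A) A | g x = g x₀} with hZ
  -- Maximum principle: an average equal to the maximum has the maximal value wherever the weight is
  -- positive.
  have hZinv : ∀ x ∈ Z, ∀ l ∈ L, maskFun B ((x + l) / R) ≠ 0 → (x + l) / R ∈ Z := by
    intro x hx l hl hm
    refine ⟨hinv x hx.1 l hl, ?_⟩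
    by_contra hne
    have hlt := lt_of_le_of_ne (hmax' _ (hinv x hx.1 l hl)) hne
    have h1 : g x < ∑ l ∈ L, ‖maskFun B ((x + l) / R)‖ ^ 2 * g x₀ := by
      rw [hharm x]
      refine Finset.sum_lt_sum (fun l hl => ?_) ⟨l, hl, ?_⟩
      · exact mul_le_mul_of_nonneg_left (hmax' _ (hinv x hx.1 l hl)) (by positivity)
      · exact mul_lt_mul_of_pos_left hlt (by positivity)
    rw [← Finset.sum_mul, hsum, one_mul, hx.2] at h1
    exact lt_irrefl _ h1
  -- An infinite `Z` would accumulate, and the identity theorem would make g constant. The constant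
  -- is g(0) = 0, as 0 is an extreme cycle point.
  have hfin : Z.Finite := by
    by_contra hinf
    obtain ⟨z, -, hz⟩ := Set.Infinite.exists_accPt_of_subset_isCompact hinf isCompact_Icc
      (Set.sep_subset _ _)
    have hfreq : ∃ᶠ x in nhdsWithin z {z}ᶜ, g x = (fun _ => g x₀) x :=
      (accPt_iff_frequently_nhdsNE.1 hz).mono fun x hx => hx.2
    have hconst := hg.eq_of_frequently_eq analyticOnNhd_const hfreq
    have h0 := hcyc 0 (isExtremeCyclePoint_zero hB hL0)
    rw [hconst] at h0
    exact hpos.ne' h0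
  obtain ⟨Z', hZ', hne, hforced⟩ := exists_forced_subset hR hRint hLint hinc hsum
    (Z := hfin.toFinset) ⟨x₀, by simpa using ⟨hx₀, rfl⟩⟩
    (fun x hx l hl hm => hfin.mem_toFinset.2 (hZinv x (hfin.mem_toFinset.1 hx) l hl hm))
  obtain ⟨c, hc, hcc⟩ := exists_isExtremeCyclePoint hne hforced
  have hcZ := hfin.mem_toFinset.1 (hZ' hc)
  exact hpos.ne' (hcZ.2.symm.trans (hcyc c hcc))

/-! ### The orthonormal basis -/

section basis

variable {R : ℝ} {B L : Finset ℝ} {μ : Measure ℝ}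

theorem orthonormal_expLp_cycleFreq [IsProbabilityMeasure μ] (hR : 1 < R)
    (hB0 : (0 : ℝ) ∈ B) (hL0 : (0 : ℝ) ∈ L)
    (hμ : IsInvariantMeasure R B μ) (hspec : IsSpectrum (B.image fun b => R⁻¹ * b) L)
    (hRint : R ∈ Set.range ((↑) : ℤ → ℝ)) (hBint : (B : Set ℝ) ⊆ Set.range ((↑) : ℤ → ℝ))
    (hLint : (L : Set ℝ) ⊆ Set.range ((↑) : ℤ → ℝ)) :
    Orthonormal ℂ fun t : cycleFreq R B L => expLp μ t := by
  refine ⟨fun t => norm_expLp μ t, fun s t hne => ?_⟩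
  refine (inner_expLp μ s t).trans ?_
  exact integral_expFun_sub_of_mem_cycleFreq hR hB0 hL0 hμ hspec hRint hBint hLint s.2 t.2
    fun h => hne (Subtype.ext h)

/-- If `h x = ∑_λ |∫ e_{-x-λ} dμ|²` with `λ` running over the frequencies, then `h` is invariant
under the transfer operator. -/
theorem eq_sum_of_hasSum (hR : 1 < R) (hB0 : (0 : ℝ) ∈ B)
    (hμ : IsInvariantMeasure R B μ) (hspec : IsSpectrum (B.image fun b => R⁻¹ * b) L)
    (hRint : R ∈ Set.range ((↑) : ℤ → ℝ)) (hBint : (B : Set ℝ) ⊆ Set.range ((↑) : ℤ → ℝ))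
    (hLint : (L : Set ℝ) ⊆ Set.range ((↑) : ℤ → ℝ)) {h : ℝ → ℝ}
    (hsum : ∀ x, HasSum (fun s : cycleFreq R B L => ‖∫ y, expFun (-x - s) y ∂μ‖ ^ 2) (h x))
    (x : ℝ) : h x = ∑ l ∈ L, ‖maskFun B ((x + l) / R)‖ ^ 2 * h ((x + l) / R) := by
  have hR0 : R ≠ 0 := by positivity
  have hmask : ∀ y s, s ∈ dualPeriods B → ‖maskFun B (-y - s)‖ = ‖maskFun B y‖ := by
    intro y s hs
    have h1 : maskFun B (-y) = (starRingEnd ℂ) (maskFun B y) := by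
      simp only [maskFun, map_mul, map_inv₀, map_sum, Complex.conj_natCast, conj_expFun]
      congr 1
      refine Finset.sum_congr rfl fun b _ => ?_
      rw [expFun_comm, expFun_neg, expFun_neg, expFun_comm]
    rw [sub_eq_add_neg, maskFun_add_of_mem ((dualPeriods B).neg_mem hs), h1, RCLike.norm_conj]
  have hterm : ∀ (l : L) (s : cycleFreq R B L),
      ‖∫ y, expFun (-x - (l + R * s)) y ∂μ‖ ^ 2 = ‖maskFun B ((x + l) / R)‖ ^ 2 *
        ‖∫ y, expFun (-((x + l) / R) - s) y ∂μ‖ ^ 2 := by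
    intro l s
    rw [show -x - (l + R * s) = R * (-((x + l) / R) - s) by field_simp; ring,
      integral_expFun_mul hR hμ, norm_mul, mul_pow,
      hmask _ _ (cycleFreq_subset_dualPeriods hB0 hRint hBint hLint s.2)]
  -- Reindex the frequencies as l + Rs and sum over s first; the inner sum is the series for h at (x
  -- + l)/R.
  have h1 := (Equiv.ofBijective _
    (bijective_add_mul hR hB0 hμ hspec hRint hBint hLint)).hasSum_iff.2 (hsum x)
  have h2 := h1.prod_fiberwise (g := fun l : L =>
    ‖maskFun B ((x + l) / R)‖ ^ 2 * h ((x + l) / R)) fun l => by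
      refine ((hsum ((x + l) / R)).mul_left (‖maskFun B ((x + l) / R)‖ ^ 2)).congr_fun ?_
      exact fun s => hterm l s
  rw [h2.unique (hasSum_fintype _)]
  exact Finset.sum_coe_sort L fun l => ‖maskFun B ((x + l) / R)‖ ^ 2 * h ((x + l) / R)

theorem orthogonal_span_expLp_cycleFreq [IsProbabilityMeasure μ] (hR : 1 < R)
    (hB0 : (0 : ℝ) ∈ B) (hL0 : (0 : ℝ) ∈ L)
    (hμ : IsInvariantMeasure R B μ) (hspec : IsSpectrum (B.image fun b => R⁻¹ * b) L)
    (hRint : R ∈ Set.range ((↑) : ℤ → ℝ)) (hBint : (B : Set ℝ) ⊆ Set.range ((↑) : ℤ → ℝ))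
    (hLint : (L : Set ℝ) ⊆ Set.range ((↑) : ℤ → ℝ)) :
    (Submodule.span ℂ (Set.range fun t : cycleFreq R B L => expLp μ t))ᗮ = ⊥ := by
  have hB : B.Nonempty := ⟨0, hB0⟩
  have horth := orthonormal_expLp_cycleFreq hR hB0 hL0 hμ hspec hRint hBint hLint
  set H := (Submodule.span ℂ (Set.range fun t : cycleFreq R B L => expLp μ t)).topologicalClosure
    with hH
  have hmem : ∀ t ∈ cycleFreq R B L, expLp μ t ∈ H := fun t ht =>
    Submodule.le_topologicalClosure _ (Submodule.subset_span ⟨⟨t, ht⟩, rfl⟩)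
  obtain ⟨C, hC⟩ := (attractor_spec hR hB).1.isBounded.exists_norm_le
  have hCae : ∀ᵐ x ∂μ, |x| ≤ C := by
    have h0 : ∀ᵐ x ∂μ, x ∈ attractor R B := measure_attractor_compl hR hB hμ
    exact h0.mono fun x hx => hC x hx
  have hsum : ∀ x, HasSum (fun s : cycleFreq R B L => ‖∫ y, expFun (-x - s) y ∂μ‖ ^ 2)
      (‖H.starProjection (expLp μ (-x))‖ ^ 2) := by
    intro x
    have h1 := hasSum_norm_sq_starProjection horth (expLp μ (-x))
    simpa only [inner_expLp] using h1
  have hharm := eq_sum_of_hasSum hR hB0 hμ hspec hRint hBint hLint hsum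
  have hone := sum_norm_maskFun_sq hR hB hspec
  have hle : ∀ t, 1 - ‖H.starProjection (expLp μ (-t))‖ ^ 2 ≤ 0 := by
    refine nonpos_of_harmonic (B := B) (L := L) hR hB hL0 hRint hLint
      (fun l hl l' hl' k hk => not_dvd_sub_of_isSpectrum hR hB hBint hspec hl hl' k hk) hone
      (fun t _ => analyticAt_const.sub (analyticAt_norm_sq_expLp hCae _ t)) (fun x => ?_)
      fun c hc => ?_
    · simp only [mul_sub, mul_one, Finset.sum_sub_distrib]
      rw [hone, ← hharm]
    · rw [Submodule.starProjection_eq_self_iff.2 (hmem _ (neg_mem_cycleFreq hc)), norm_expLp]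
      norm_num
  -- A unit vector whose projection has norm at least 1 lies in the subspace.
  have hall : ∀ t, expLp μ t ∈ H := by
    intro t
    rw [Submodule.mem_iff_norm_starProjection]
    have h1 := hle (-t)
    rw [neg_neg] at h1
    have h2 := H.norm_starProjection_apply_le (expLp μ t)
    rw [norm_expLp] at h2 ⊢
    nlinarith [norm_nonneg (H.starProjection (expLp μ t))]
  rw [← Submodule.orthogonal_closure, Submodule.eq_bot_iff]
  exact fun f hf => eq_zero_of_inner_expLp μ fun t => (Submodule.mem_orthogonal _ _).1 hf _ (hall t)

theorem cuntzWord_ae_eq (hR : 1 < R) (hB0 : (0 : ℝ) ∈ B) (hμ : IsInvariantMeasure R B μ)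
    (hRint : R ∈ Set.range ((↑) : ℤ → ℝ)) (hBint : (B : Set ℝ) ⊆ Set.range ((↑) : ℤ → ℝ))
    (hLint : (L : Set ℝ) ⊆ Set.range ((↑) : ℤ → ℝ)) {w : List ℝ} (hw : ∀ l ∈ w, l ∈ L) {c : ℝ}
    (hc : IsExtremeCyclePoint R B L c) :
    cuntzWord R B w (expFun (-c)) =ᵐ[μ] expFun (wordFreq R w (-c)) := by
  have h0 : ∀ᵐ x ∂μ, x ∈ attractor R B := measure_attractor_compl hR ⟨0, hB0⟩ hμ
  exact h0.mono (cuntzWord_expFun hR ⟨0, hB0⟩ hRint hBint hLint hw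
    ((dualPeriods B).neg_mem (hc.mem_dualPeriods hB0)))

/-- Different pairs (w, c) may give the same frequency (prepending the letter 0 to a word with
frequency 0, for instance), so the basis is indexed by frequencies and compared with the family as a
set. -/
theorem range_expLp_cycleFreq [IsProbabilityMeasure μ] (hR : 1 < R)
    (hB0 : (0 : ℝ) ∈ B) (hμ : IsInvariantMeasure R B μ)
    (hRint : R ∈ Set.range ((↑) : ℤ → ℝ)) (hBint : (B : Set ℝ) ⊆ Set.range ((↑) : ℤ → ℝ))
    (hLint : (L : Set ℝ) ⊆ Set.range ((↑) : ℤ → ℝ)) :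
    Set.range (fun t : cycleFreq R B L => expLp μ t) = cycleFamily R B L μ := by
  ext v
  constructor
  · rintro ⟨⟨t, w, c, hw, hc, rfl⟩, rfl⟩
    exact ⟨w, c, hw, hc, (coeFn_expLp μ _).trans
      (cuntzWord_ae_eq hR hB0 hμ hRint hBint hLint hw hc).symm⟩
  · rintro ⟨w, c, hw, hc, hv⟩
    refine ⟨⟨wordFreq R w (-c), w, c, hw, hc, rfl⟩, Lp.ext ?_⟩
    exact (coeFn_expLp μ _).trans
      ((cuntzWord_ae_eq hR hB0 hμ hRint hBint hLint hw hc).symm.trans hv.symm)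

end basis

end

end CuntzBasis

/-! ### The orthonormal basis generated by the extreme cycles. -/

theorem mainTheorem6 (R : ℝ) (B L : Finset ℝ) (μ : Measure ℝ)
    (hR : 1 < R) (hB0 : (0 : ℝ) ∈ B) (hL0 : (0 : ℝ) ∈ L)
    (hμ : CuntzBasis.IsInvariantMeasure R B μ)
    (hover : CuntzBasis.NoOverlap R B μ)
    (hspec : CuntzBasis.IsSpectrum (B.image fun b => R⁻¹ * b) L)
    (hRint : R ∈ Set.range ((↑) : ℤ → ℝ))
    (hBint : (B : Set ℝ) ⊆ Set.range ((↑) : ℤ → ℝ))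
    (hLint : (L : Set ℝ) ⊆ Set.range ((↑) : ℤ → ℝ)) :
    (∀ w : List ℝ, (∀ l ∈ w, l ∈ L) → ∀ c : ℝ, CuntzBasis.IsExtremeCyclePoint R B L c →
      ∃ t : ℝ, CuntzBasis.cuntzWord R B w (CuntzBasis.expFun (-c)) =ᵐ[μ] CuntzBasis.expFun t) ∧
    ∃ (Λ : Set ℝ) (E : HilbertBasis Λ ℂ (Lp ℂ 2 μ)),
      (∀ t : Λ, E t =ᵐ[μ] CuntzBasis.expFun t) ∧
      Set.range E = CuntzBasis.cycleFamily R B L μ := by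
  have := hμ.isProbabilityMeasure
  refine ⟨fun w hw c hc =>
    ⟨_, CuntzBasis.cuntzWord_ae_eq hR hB0 hμ hRint hBint hLint hw hc⟩, ?_⟩
  have horth := CuntzBasis.orthonormal_expLp_cycleFreq hR hB0 hL0 hμ hspec hRint hBint hLint
  have hspan := CuntzBasis.orthogonal_span_expLp_cycleFreq hR hB0 hL0 hμ hspec hRint hBint hLint
  refine ⟨CuntzBasis.cycleFreq R B L, HilbertBasis.mkOfOrthogonalEqBot horth hspan, ?_, ?_⟩
  · rw [HilbertBasis.coe_mkOfOrthogonalEqBot]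
    exact fun t => CuntzBasis.coeFn_expLp μ t
  · rw [HilbertBasis.coe_mkOfOrthogonalEqBot]
    exact CuntzBasis.range_expLp_cycleFreq hR hB0 hμ hRint hBint hLint
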